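/- Let $e$ be an even positive integer and $q=2^e$. Let $\operatorname{Tr}_{q^2}$ denote the absolute trace from $\mathbb{F}_{q^2}$ to $\mathbb{F}_2$. Put $d=(q^2+q+1)/3$ and consider the polynomial $\sigma(X)=X+X^d+X^{dq}\in\mathbb{F}_{q^2}[X]$. Then $\sigma$ is a permutation polynomial of $\mathbb{F}_{q^2}$, so that for every $\alpha\in\mathbb{F}_q^*$ one may define the Boolean function $$f_\alpha(x)=\operatorname{Tr}_{q^2}\bigl(\alpha(\sigma^{-1}(x))^3\bigr),\qquad x\in\mathbb{F}_{q^2},$$ and its Walsh transform $$W_{f_\alpha}(\beta)=\sum_{x\in\mathbb{F}_{q^2}}(-1)^{f_\alpha(x)+\operatorname{Tr}_{q^2}(\beta x)},\qquad \beta\in\mathbb{F}_{q^2}.$$ For every $\alpha\in\mathbb{F}_q^*$ the following hold. (a) If $\alpha$ is a cube in $\mathbb{F}_q$, then $$\{W_{f_\alpha}(\beta):\beta\in\mathbb{F}_{q^2}\setminus\mathbb{F}_q\}=\begin{cases}\{0\},& e=2,\\ \{-2q,0,2q\},& e\ge 4.\end{cases}$$ (b) If $\alpha$ is not a cube in $\mathbb{F}_q$,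 then $$\{W_{f_\alpha}(\beta):\beta\in\mathbb{F}_{q^2}\setminus\mathbb{F}_q\}=\{q,-q\}.$$ -/

import Mathlib

namespace WalshInverse

/-- The polynomial `σ(X) = X + X ^ d + X ^ (d * q)` over `K`, where `d = (q ^ 2 + q + 1) / 3`.
The division is exact as soon as `q ≡ 1` modulo `3`, in particular for `q = 2 ^ e`, `e` even. -/
noncomputable def sigmaPoly (K : Type*) [Field K] (q : ℕ) : Polynomial K :=
  Polynomial.X + Polynomial.X ^ ((q ^ 2 + q + 1) / 3) +
    Polynomial.X ^ ((q ^ 2 + q + 1) / 3 * q)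

/-- The polynomial function `K → K` induced by `σ`. -/
noncomputable def sigma (K : Type*) [Field K] (q : ℕ) (x : K) : K :=
  (sigmaPoly K q).eval x

/-- The inverse map of `σ`. It is the two-sided inverse whenever `σ` is a bijection of `K`. -/
noncomputable def sigmaInv (K : Type*) [Field K] (q : ℕ) : K → K :=
  Function.invFun (sigma K q)

/-- The Boolean function `f_a (x) = Tr (a * (σ⁻¹ x) ^ 3)`, with the absolute trace
from `K` to `𝔽₂ = ZMod 2`. -/
noncomputable def boolFun {K : Type*} [Field K] [Algebra (ZMod 2) K] (q : ℕ) (a : K) (x : K) :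
    ZMod 2 :=
  Algebra.trace (ZMod 2) K (a * sigmaInv K q x ^ 3)

/-- The Walsh transform of a Boolean function `f` on a finite field `K` of characteristic two:
`W_f (β) = ∑ x, (-1) ^ (f x + Tr (β * x))`. -/
noncomputable def walsh {K : Type*} [Field K] [Fintype K] [Algebra (ZMod 2) K]
    (f : K → ZMod 2) (β : K) : ℤ :=
  ∑ x : K, (-1 : ℤ) ^ (f x + Algebra.trace (ZMod 2) K (β * x)).val

end WalshInverse

namespace WalshInverse

open Finset Classical

section

/-! Write K for the field with q^2 elements, c x = x^q for conjugation, χ for the trace character,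
and E x = c(x)^2. Then E(E x) = x^4, and E fixes only 0 and 1.

Reduction to Kasami sums. Every nonzero element of K is t z^3 with t in the subfield, and σ(t z^3) =
z t (z^2 + z c(z) + c(z)^2). Summing over the three classes modulo cubes and substituting z + ω c(z)
for z turns W(β) into the sum of χ(α κ(y) + b y) over y, where κ(y) = y E²(y) / E(y) is a Kasami
power map and b = ω^2 β + ω c(β) (`sum_char_sigma`).

Reduction to radicals. The map z ↦ z E(z) has the same fibre sizes as z ↦ z^3, and κ(z E z) = z
E³(z) is quadratic in z. So three times a Kasami sum is a sum of three quadratic exponential sums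
(`three_mul_kasSum`). One with radical of order 4^r has absolute value q 2^r, and being 1 modulo 3
it equals q (-2)^r (`quadSum_eq`). Nonzero radical points lie over the y ≠ 0 with `psi` equal to 0
or 1. At a zero of `psi`, scaled to y = 1, the radical polynomial decomposes into additive maps of
degree 4, and the radicals can be counted.

Noncubes. Whenever `psi` has a zero, its value 1 is taken at least as often as 0. Averaged over b
the two counts agree, so they agree for every b, and only ±q can occur (`kasSum_noncube`).

Cubes. All sums are bounded by 2q in absolute value, and at least three quarters of the pairs (a, b)
give 0. Parseval then leaves no slack, which forces the values 0 and ±2q (`kasSum_cube`).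

Which values occur off the subfield follows from the first two moments of W. For a cube the values
on the subfield are also needed: they are Gold sums of square 4q^2, and for q = 4 they exhaust what
Parseval allows. -/

theorem card_filter_eq {X : Type*} [Fintype X] (a : X) : (univ.filter fun x => x = a).card = 1 :=
  card_eq_one.2 ⟨a, by ext; simp⟩

theorem sum_fiber {X : Type*} [Fintype X] {F : X → ℤ} (f : X → X) :
    ∑ z, F (f z) = ∑ y, ((univ.filter fun z => f z = y).card : ℤ) * F y := by
  rw [← Finset.sum_fiberwise (s := univ) (g := f)]
  refine sum_congr rfl fun y _ => ?_
  rw [sum_congr rfl (g := fun _ => F y)]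
  · simp
  · intro z hz
    rw [(mem_filter.1 hz).2]

/-! ### Cubes and classes modulo cubes -/

variable {K : Type*} [Field K]

theorem cube_mul {x y : K} (hx : ∃ c, c ^ 3 = x) (hy : ∃ c, c ^ 3 = y) : ∃ c, c ^ 3 = x * y := by
  obtain ⟨c, rfl⟩ := hx
  obtain ⟨d, rfl⟩ := hy
  exact ⟨c * d, by ring⟩

theorem cube_inv {x : K} (hx : ∃ c, c ^ 3 = x) : ∃ c, c ^ 3 = x⁻¹ := by
  obtain ⟨c, rfl⟩ := hx
  exact ⟨c⁻¹, by simp⟩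

theorem cube_of_mul {x y : K} (h : ∃ c, c ^ 3 = x * y) (hx : ∃ c, c ^ 3 = x) (hx0 : x ≠ 0) :
    ∃ c, c ^ 3 = y := by
  have := cube_mul (cube_inv hx) h
  rwa [inv_mul_cancel_left₀ hx0] at this

theorem cube_of_sq {x : K} (h : ∃ c, c ^ 3 = x ^ 2) : ∃ c, c ^ 3 = x := by
  rcases eq_or_ne x 0 with rfl | hx
  · exact ⟨0, by simp⟩
  · refine cube_of_mul (x := x ^ 2) ⟨x, by ring⟩ h (pow_ne_zero 2 hx)

/-- The unit group is cyclic, and a noncube has exponent prime to 3, so its powers represent every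
exponent modulo 3. -/
theorem exists_rep_mod_cubes [Finite K] {g : K} (hg : ¬ ∃ c, c ^ 3 = g) {y : K} (hy : y ≠ 0) :
    ∃ i < 3, ∃ c, y = g ^ i * c ^ 3 := by
  have hg0 : g ≠ 0 := by rintro rfl; exact hg ⟨0, by simp⟩
  obtain ⟨ζ, hζ⟩ := IsCyclic.exists_generator (α := Kˣ)
  obtain ⟨m, hm⟩ := hζ (Units.mk0 g hg0)
  obtain ⟨n, hn⟩ := hζ (Units.mk0 y hy)
  have hm3 : m % 3 ≠ 0 := by
    intro h
    apply hg
    refine ⟨((ζ ^ (m / 3) : Kˣ) : K), ?_⟩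
    have : (ζ ^ (m / 3)) ^ 3 = Units.mk0 g hg0 := by
      rw [← hm, ← zpow_natCast, ← zpow_mul]
      congr 1; push_cast; omega
    rw [← Units.val_pow_eq_pow_val, this]; rfl
  have : ∃ i : ℕ, i < 3 ∧ (n - i * m) % 3 = 0 := by
    have h1 : m % 3 = 1 ∨ m % 3 = 2 := by omega
    have h2 : n % 3 = 0 ∨ n % 3 = 1 ∨ n % 3 = 2 := by omega
    rcases h2 with h2 | h2 | h2
    · exact ⟨0, by norm_num, by push_cast; omega⟩
    · rcases h1 with h1 | h1
      · exact ⟨1, by norm_num, by push_cast; omega⟩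
      · exact ⟨2, by norm_num, by push_cast; omega⟩
    · rcases h1 with h1 | h1
      · exact ⟨2, by norm_num, by push_cast; omega⟩
      · exact ⟨1, by norm_num, by push_cast; omega⟩
  obtain ⟨i, hi, hd⟩ := this
  refine ⟨i, hi, ((ζ ^ ((n - i * m) / 3) : Kˣ) : K), ?_⟩
  have : Units.mk0 y hy = (Units.mk0 g hg0) ^ i * (ζ ^ ((n - i * m) / 3)) ^ 3 := by
    rw [← hm, ← hn]
    simp only
    rw [← zpow_natCast, ← zpow_natCast, ← zpow_mul, ← zpow_mul, ← zpow_add]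
    congr 1
    have := Int.mul_ediv_cancel' (Int.dvd_of_emod_eq_zero hd)
    push_cast
    linarith
  have := congrArg (Units.val) this
  simpa using this

theorem omega_ne_zero {ω : K} (hω : ω ^ 2 = ω + 1) : ω ≠ 0 := by rintro rfl; simp at hω

section

variable [CharP K 2] {ω : K}

theorem omega_ne_one (hω : ω ^ 2 = ω + 1) : ω ≠ 1 := by
  rintro rfl
  have h : (2 : K) = 0 := CharTwo.two_eq_zero
  have : (1 : K) = 0 := by grind
  exact one_ne_zero this

theorem cube_roots_of_unity (hω : ω ^ 2 = ω + 1) {x : K} (hx : x ^ 3 = 1) :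
    x = 1 ∨ x = ω ∨ x = ω + 1 := by
  have : (x - 1) * ((x - ω) * (x - (ω + 1))) = 0 := by grind
  rcases mul_eq_zero.1 this with h | h
  · exact Or.inl (sub_eq_zero.1 h)
  · rcases mul_eq_zero.1 h with h | h
    · exact Or.inr (Or.inl (sub_eq_zero.1 h))
    · exact Or.inr (Or.inr (sub_eq_zero.1 h))

theorem card_triple (hω : ω ^ 2 = ω + 1) {z : K} (hz : z ≠ 0) :
    ({z, ω * z, (ω + 1) * z} : Finset K).card = 3 := by
  have h0 := omega_ne_zero hω
  have h1 := omega_ne_one hω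
  rw [card_eq_three]
  refine ⟨_, _, _, ?_, ?_, ?_, rfl⟩
  · intro h
    apply h1
    exact mul_right_cancel₀ hz (by rw [← h, one_mul])
  · intro h
    apply h0
    have := mul_right_cancel₀ hz (h.symm.trans (one_mul z).symm)
    simpa using this
  · intro h
    have := mul_right_cancel₀ hz h
    simp at this

end

/-- The properties of the field automorphism `E x = x ^ (2 * q)` of the field with `q ^ 2`
elements, `q = 2 ^ e` with `e` even, on which the evaluation of the Walsh transform rests.
The element `ω` is a primitive cube root of unity. -/
structure TwistedFrobenius [Fintype K] [CharP K 2]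
    (E : K →+* K) (ω : K) (q : ℕ) : Prop where
  card : Fintype.card K = q ^ 2
  q_mod : q % 3 = 1
  sq : ∀ x, E (E x) = x ^ 4
  omega_sq : ω ^ 2 = ω + 1
  map_omega : E ω = ω + 1
  norm_cube : ∀ x, ∃ c, x * E x = c ^ 3
  norm_eq_one : ∀ x, x * E x = 1 → x ^ 3 = 1

variable [Fintype K] [CharP K 2] {E : K →+* K} {ω : K} {q : ℕ}

theorem filter_cube_eq (hω : ω ^ 2 = ω + 1) {z : K} :
    (univ.filter fun x : K => x ^ 3 = z ^ 3) = {z, ω * z, (ω + 1) * z} := by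
  ext x
  simp only [mem_filter, mem_univ, true_and, mem_insert, mem_singleton]
  constructor
  · intro h
    have : (x - z) * ((x - ω * z) * (x - (ω + 1) * z)) = 0 := by grind
    rcases mul_eq_zero.1 this with h | h
    · exact Or.inl (sub_eq_zero.1 h)
    · rcases mul_eq_zero.1 h with h | h
      · exact Or.inr (Or.inl (sub_eq_zero.1 h))
      · exact Or.inr (Or.inr (sub_eq_zero.1 h))
  · rintro (rfl | rfl | rfl) <;> grind

/-- A nonzero cube has exactly three cube roots. -/
theorem card_cube_roots (hω : ω ^ 2 = ω + 1) {c : K} (hc : c ≠ 0) :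
    (univ.filter fun x : K => x ^ 3 = c).card = if ∃ d, d ^ 3 = c then 3 else 0 := by
  split_ifs with h
  · obtain ⟨d, rfl⟩ := h
    rw [filter_cube_eq hω, card_triple hω]
    rintro rfl; simp at hc
  · rw [card_eq_zero, filter_eq_empty_iff]
    intro x _ hx
    exact h ⟨x, hx⟩

/-- Summation over the field through the three classes modulo cubes. -/
theorem sum_classes (hω : ω ^ 2 = ω + 1) {g : K} (hg : ¬ ∃ c, c ^ 3 = g) (F : K → ℤ) :
    ∑ z, F (z ^ 3) + ∑ z, F (g * z ^ 3) + ∑ z, F (g ^ 2 * z ^ 3) = 3 * ∑ y, F y := by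
  have hg0 : g ≠ 0 := by rintro rfl; exact hg ⟨0, by simp⟩
  have hg2 : ¬ ∃ c, c ^ 3 = g ^ 2 := fun h => hg (cube_of_sq h)
  rw [sum_fiber fun z : K => z ^ 3, sum_fiber fun z : K => g * z ^ 3,
    sum_fiber fun z : K => g ^ 2 * z ^ 3, mul_sum, ← sum_add_distrib, ← sum_add_distrib]
  refine sum_congr rfl fun y _ => ?_
  rw [← add_mul, ← add_mul]
  congr 1
  norm_cast
  rcases eq_or_ne y 0 with rfl | hy
  · simp [hg0, card_filter_eq]
  have key : ∀ d : K, d ≠ 0 → (univ.filter fun z : K => d * z ^ 3 = y).card =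
      if ∃ c, c ^ 3 = d⁻¹ * y then 3 else 0 := by
    intro d hd
    rw [← card_cube_roots hω (mul_ne_zero (inv_ne_zero hd) hy)]
    congr 1
    ext z
    simp only [mem_filter, mem_univ, true_and]
    rw [eq_inv_mul_iff_mul_eq₀ hd]
  have k1 := key 1 one_ne_zero
  simp only [one_mul, inv_one] at k1
  rw [k1, key g hg0, key _ (pow_ne_zero 2 hg0)]
  have hc : ∀ c : K, ∃ d, d ^ 3 = c ^ 3 := fun c => ⟨c, rfl⟩
  obtain ⟨i, hi, c, rfl⟩ := exists_rep_mod_cubes hg hy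
  have hc0 : c ^ 3 ≠ 0 := right_ne_zero_of_mul hy
  have n1 : ¬ ∃ d, d ^ 3 = g * c ^ 3 := fun h =>
    hg (cube_of_mul (by rwa [mul_comm] at h) (hc c) hc0)
  have n2 : ¬ ∃ d, d ^ 3 = g ^ 2 * c ^ 3 := fun h =>
    hg2 (cube_of_mul (by rwa [mul_comm] at h) (hc c) hc0)
  have i1 : ∀ x : K, (¬ ∃ d, d ^ 3 = x) → ¬ ∃ d, d ^ 3 = x⁻¹ := fun x hx h =>
    hx (by simpa only [inv_inv] using cube_inv h)
  interval_cases i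
  · have m1 : ¬ ∃ d, d ^ 3 = g⁻¹ * c ^ 3 := fun h =>
      i1 g hg (cube_of_mul (by rwa [mul_comm] at h) (hc c) hc0)
    have m2 : ¬ ∃ d, d ^ 3 = (g ^ 2)⁻¹ * c ^ 3 := fun h =>
      i1 _ hg2 (cube_of_mul (by rwa [mul_comm] at h) (hc c) hc0)
    simp only [pow_zero, one_mul]
    rw [if_pos (hc c), if_neg m1, if_neg m2]
  · have m2 : ¬ ∃ d, d ^ 3 = (g ^ 2)⁻¹ * (g ^ 1 * c ^ 3) := by
      have : (g ^ 2)⁻¹ * (g ^ 1 * c ^ 3) = c ^ 3 * g⁻¹ := by field_simp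
      rw [this]
      exact fun h => i1 g hg (cube_of_mul h (hc c) hc0)
    have m1 : g⁻¹ * (g ^ 1 * c ^ 3) = c ^ 3 := by field_simp
    rw [if_neg (by simpa using n1), m1, if_pos (hc c), if_neg m2]
  · have m1 : g⁻¹ * (g ^ 2 * c ^ 3) = g * c ^ 3 := by field_simp
    have m2 : (g ^ 2)⁻¹ * (g ^ 2 * c ^ 3) = c ^ 3 := by field_simp
    rw [if_neg n2, m1, if_neg n1, m2, if_pos (hc c)]

/-! ### The map z ↦ z E(z) compared with z ↦ z^3 -/

namespace TwistedFrobenius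

variable (h : TwistedFrobenius E ω q)

include h

theorem eq_of_fixed {x : K} (hx : E x = x) : x = 0 ∨ x = 1 := by
  have h4 : x ^ 4 = x := by rw [← h.sq, hx, hx]
  rcases eq_or_ne x 0 with h0 | h0
  · exact Or.inl h0
  right
  have h3 : x ^ 3 = 1 := mul_right_cancel₀ h0 (by rw [one_mul, ← h4]; grind)
  have hm := h.map_omega
  rcases cube_roots_of_unity h.omega_sq h3 with rfl | rfl | rfl
  · rfl
  · rw [hm] at hx; simp at hx
  · rw [map_add, hm, map_one] at hx
    simp at hx

theorem cube_eq_one_iff {x : K} : x * E x = 1 ↔ x ^ 3 = 1 := by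
  refine ⟨h.norm_eq_one x, fun hx => ?_⟩
  have hm := h.map_omega
  have h2 := h.omega_sq
  rcases cube_roots_of_unity h.omega_sq hx with rfl | rfl | rfl
  · simp
  · rw [hm]; grind
  · rw [map_add, hm, map_one]; grind

/-- On units, z ↦ z E(z) and z ↦ z^3 are homomorphisms with the same kernel, hence with images of
equal order; the first image lies in the second, so they coincide. -/
theorem exists_norm_eq {c : K} (hc : c ≠ 0) : ∃ z, z * E z = c ^ 3 := by
  let f : Kˣ →* Kˣ := powMonoidHom 3
  let g : Kˣ →* Kˣ := MonoidHom.id Kˣ * Units.map (E : K →* K)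
  have hg : ∀ u, ((g u : Kˣ) : K) = u * E u := fun u => rfl
  have hker : f.ker = g.ker := by
    ext u
    rw [MonoidHom.mem_ker, MonoidHom.mem_ker, Units.ext_iff, Units.ext_iff, hg]
    have := h.cube_eq_one_iff (x := (u : K))
    simpa [f] using this.symm
  have hle : g.range ≤ f.range := by
    rintro _ ⟨u, rfl⟩
    obtain ⟨c, hc⟩ := h.norm_cube u
    have hc0 : c ≠ 0 := by
      rintro rfl
      simp at hc
    exact ⟨Units.mk0 c hc0, by ext; rw [hg, hc]; simp [f]⟩
  have hcard : Nat.card f.range = Nat.card g.range := by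
    rw [← Subgroup.index_ker, ← Subgroup.index_ker, hker]
  have heq : g.range = f.range := Subgroup.eq_of_le_of_card_ge hle hcard.le
  have : f (Units.mk0 c hc) ∈ g.range := heq ▸ ⟨_, rfl⟩
  obtain ⟨u, hu⟩ := this
  refine ⟨u, ?_⟩
  rw [← hg, hu]; simp [f]

theorem card_norm_fiber {c : K} (hc : c ≠ 0) :
    (univ.filter fun z : K => z * E z = c).card = if ∃ d, d ^ 3 = c then 3 else 0 := by
  split_ifs with hd
  · obtain ⟨d, rfl⟩ := hd
    have hd0 : d ≠ 0 := by rintro rfl; simp at hc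
    obtain ⟨z, hz⟩ := h.exists_norm_eq hd0
    have hz0 : z ≠ 0 := by rintro rfl; rw [zero_mul] at hz; exact hc hz.symm
    have hEz : E z ≠ 0 := by simpa using hz0
    rw [← hz, ← card_triple h.omega_sq hz0, ← filter_cube_eq h.omega_sq]
    congr 1
    ext x
    simp only [mem_filter, mem_univ, true_and]
    have := h.cube_eq_one_iff (x := x / z)
    rwa [map_div₀, div_pow, div_mul_div_comm, div_eq_one_iff_eq (mul_ne_zero hz0 hEz),
      div_eq_one_iff_eq (pow_ne_zero 3 hz0)] at this
  · rw [card_eq_zero, filter_eq_empty_iff]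
    intro x _ hx
    obtain ⟨d, hd'⟩ := h.norm_cube x
    exact hd ⟨d, by rw [← hd', hx]⟩

theorem sum_norm (F : K → ℤ) : ∑ z, F (z * E z) = ∑ z, F (z ^ 3) := by
  rw [sum_fiber fun z : K => z * E z, sum_fiber fun z : K => z ^ 3]
  refine sum_congr rfl fun y _ => ?_
  congr 2
  rcases eq_or_ne y 0 with rfl | hy
  · congr 1; ext; simp
  · rw [h.card_norm_fiber hy, card_cube_roots h.omega_sq hy]

theorem sum_norm_classes {g : K} (hg : ¬ ∃ c, c ^ 3 = g) (F : K → ℤ) :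
    ∑ z, F (z * E z) + ∑ z, F (g * (z * E z)) + ∑ z, F (g ^ 2 * (z * E z)) = 3 * ∑ y, F y := by
  rw [h.sum_norm F, h.sum_norm fun y => F (g * y), h.sum_norm fun y => F (g ^ 2 * y)]
  exact sum_classes h.omega_sq hg F

/-- A sum over the values `z * E z` is, modulo `3`, its term at `0`. -/
theorem sum_norm_modEq (F : K → ℤ) : ∃ m, ∑ z, F (z * E z) = F 0 + 3 * m := by
  refine ⟨∑ y ∈ univ.filter (fun y => y ≠ 0 ∧ ∃ d, d ^ 3 = y), F y, ?_⟩
  rw [sum_fiber fun z : K => z * E z, ← add_sum_erase univ _ (mem_univ (0 : K)), mul_sum,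
    sum_filter]
  congr 1
  · simp [card_filter_eq]
  · rw [← add_sum_erase univ _ (mem_univ (0 : K))]
    simp only [ne_eq, not_true_eq_false, false_and, if_false, zero_add]
    refine sum_congr rfl fun y hy => ?_
    have hy0 := ne_of_mem_erase hy
    rw [h.card_norm_fiber hy0]
    simp only [hy0, not_false_eq_true, true_and]
    split_ifs <;> simp

end TwistedFrobenius

end

/-! ### The Kasami map and its exponential sums -/

section

variable {K : Type*} [Field K]

/-- The Kasami power map `y ↦ y * E² y / E y`. -/
noncomputable def kas (E : K →+* K) (y : K) : K := y ^ 5 / E y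

/-- The linearized polynomial whose zeros form the radical of the quadratic form
`z ↦ Tr (a * z * E³ z + b * z * E z)`. -/
def kerPoly (E : K →+* K) (a b z : K) : K :=
  E a ^ 4 * z ^ 64 + E b ^ 4 * z ^ 16 + b ^ 4 * z ^ 4 + a * z

/-- The function which is fixed by `E` exactly at the values `y = z * E z`, `z` in the radical. -/
noncomputable def psi (E : K →+* K) (a b y : K) : K :=
  (a * kas E y) ^ 4 + E (a * kas E y) + a * kas E y + (b * y) ^ 4

theorem kas_mul (E : K →+* K) (x y : K) : kas E (x * y) = kas E x * kas E y := by
  simp only [kas, map_mul, mul_pow, mul_div_mul_comm]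

theorem kas_zero (E : K →+* K) : kas E 0 = 0 := by simp [kas]

theorem kas_one (E : K →+* K) : kas E 1 = 1 := by simp [kas]

theorem kas_ne_zero {E : K →+* K} {y : K} (hy : y ≠ 0) : kas E y ≠ 0 := by
  simp [kas, hy]

theorem psi_scale (E : K →+* K) (a b x y : K) :
    psi E (a * kas E x) (b * x) y = psi E a b (x * y) := by
  simp only [psi, kas_mul, mul_assoc]

variable [Fintype K]

/-- The Walsh transform of `y ↦ Tr (a * kas y)`. -/
noncomputable def kasSum (χ : AddChar K ℤ) (E : K →+* K) (a b : K) : ℤ :=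
  ∑ y, χ (a * kas E y + b * y)

/-- The exponential sum of the quadratic form `z ↦ Tr (a * z * E³ z + b * z * E z)`. -/
def quadSum (χ : AddChar K ℤ) (E : K →+* K) (a b : K) : ℤ :=
  ∑ z, χ (a * (z * E z ^ 4) + b * (z * E z))

/-- The number of zeros of `kerPoly`. -/
noncomputable def kerCard (E : K →+* K) (a b : K) : ℕ :=
  (univ.filter fun z => kerPoly E a b z = 0).card

theorem kasSum_scale (χ : AddChar K ℤ) (E : K →+* K) (a b : K) {x : K} (hx : x ≠ 0) :
    kasSum χ E (a * kas E x) (b * x) = kasSum χ E a b := by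
  unfold kasSum
  rw [← Equiv.sum_comp (Equiv.mulLeft₀ x hx) fun y => χ (a * kas E y + b * y)]
  simp only [Equiv.mulLeft₀_apply, kas_mul, mul_assoc]

end

/-! ### Exponential sums of quadratic forms and their radicals -/

section

variable {K : Type*} [Field K] {χ : AddChar K ℤ}

theorem char_mul_self [CharP K 2] (x : K) : χ x * χ x = 1 := by
  rw [← AddChar.map_add_eq_mul, CharTwo.add_self_eq_zero, AddChar.map_zero_eq_one]

variable [Fintype K]

/-- The square of the exponential sum of a quadratic form `Q` with radical `R`. -/
theorem sq_sum_quadratic (hχ : χ.IsPrimitive) (Q B f : K → K) (hf : f.Bijective)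
    (hQ : ∀ z u, χ (Q z + Q (z + u)) = χ (Q u) * χ (f z * B u)) :
    (∑ z, χ (Q z)) ^ 2 = Fintype.card K * ∑ u ∈ univ.filter (fun u => B u = 0), χ (Q u) := by
  have h1 : (∑ z, χ (Q z)) ^ 2 = ∑ z, ∑ u, χ (Q z + Q (z + u)) := by
    rw [sq, sum_mul_sum]
    refine sum_congr rfl fun z _ => ?_
    rw [← Equiv.sum_comp (Equiv.addLeft z) fun u => χ (Q z) * χ (Q u)]
    simp only [Equiv.coe_addLeft, AddChar.map_add_eq_mul]
  rw [h1, sum_comm]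
  simp only [hQ, ← mul_sum]
  have h2 : ∀ u, ∑ z, χ (f z * B u) = if B u = 0 then (Fintype.card K : ℤ) else 0 := by
    intro u
    rw [hf.sum_comp (fun z => χ (z * B u)), AddChar.sum_mulShift _ hχ]
    split_ifs <;> simp
  simp only [h2, mul_ite, mul_zero]
  rw [← sum_filter, mul_sum]
  exact sum_congr rfl fun u _ => mul_comm _ _

end

namespace TwistedFrobenius

variable {K : Type*} [Field K] [Fintype K] [CharP K 2] {E : K →+* K} {ω : K} {q : ℕ}
  (h : TwistedFrobenius E ω q)

include h

/-- Pulling back along z ↦ z E(z) makes the Kasami map quadratic: E(z)^4 is E³(z). -/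
theorem kas_norm (z : K) : kas E (z * E z) = z * E z ^ 4 := by
  rcases eq_or_ne z 0 with rfl | hz
  · simp [kas]
  have hz' : E z ≠ 0 := by simpa using hz
  rw [kas, map_mul, h.sq, div_eq_iff (mul_ne_zero hz' (pow_ne_zero 4 hz))]
  ring

theorem kas_cube (y : K) : ∃ c, c ^ 3 = kas E y := by
  rcases eq_or_ne y 0 with rfl | hy
  · exact ⟨0, by simp [kas]⟩
  have hy' : E y ≠ 0 := by simpa using hy
  obtain ⟨c, hc⟩ := h.norm_cube y
  have hc0 : c ≠ 0 := by
    rintro rfl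
    simp [hy] at hc
  refine ⟨y ^ 2 / c, ?_⟩
  rw [kas, div_pow, ← hc]
  field_simp

theorem bijective_cube : Function.Bijective fun z => E z ^ 4 := by
  have : (fun z => E z ^ 4) = E ∘ E ∘ E := by
    ext z; simp [h.sq]
  have hb : Function.Bijective E := Finite.injective_iff_bijective.1 E.injective
  rw [this]
  exact hb.comp (hb.comp hb)

variable {χ : AddChar K ℤ} (hχ : χ.IsPrimitive) (hE : ∀ x, χ (E x) = χ x)

theorem three_mul_kasSum {g : K} (hg : ¬ ∃ c, c ^ 3 = g) (a b : K) :
    3 * kasSum χ E a b = quadSum χ E a b + quadSum χ E (a * kas E g) (b * g) +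
      quadSum χ E (a * kas E (g ^ 2)) (b * g ^ 2) := by
  unfold kasSum quadSum
  rw [← h.sum_norm_classes hg]
  simp only [kas_mul, h.kas_norm, mul_assoc]

/-- The summand depends only on z E(z), whose nonempty fibres away from 0 have three points. This
congruence later decides the sign. -/
theorem quadSum_modEq (a b : K) : ∃ m, quadSum χ E a b = 1 + 3 * m := by
  obtain ⟨m, hm⟩ := h.sum_norm_modEq fun y => χ (a * kas E y + b * y)
  refine ⟨m, ?_⟩
  rw [quadSum]
  simpa only [h.kas_norm, kas_zero, mul_zero, add_zero, AddChar.map_zero_eq_one] using hm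

/-- `psi` takes the values `0` and `1` exactly at the points coming from the radical. -/
theorem psi_norm_iff {a b z : K} (hz : z ≠ 0) :
    (psi E a b (z * E z) = 0 ∨ psi E a b (z * E z) = 1) ↔ kerPoly E a b z = 0 := by
  -- The sum E(psi) + psi telescopes to the radical polynomial, so radical points are those where
  -- `psi` is fixed by E, that is, equal to 0 or 1.
  have key : E (psi E a b (z * E z)) + psi E a b (z * E z) = E z ^ 4 * kerPoly E a b z := by
    simp only [psi, kerPoly, h.kas_norm, map_mul, map_add, map_pow, h.sq]
    grind
  have hz' : E z ^ 4 ≠ 0 := by simpa using hz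
  constructor
  · intro hp
    have : E z ^ 4 * kerPoly E a b z = 0 := by
      rw [← key]
      rcases hp with hp | hp <;> rw [hp]
      · simp
      · simpa using CharTwo.add_self_eq_zero (1 : K)
    exact (mul_eq_zero.1 this).resolve_left hz'
  · intro hk
    apply h.eq_of_fixed
    rw [hk, mul_zero] at key
    exact CharTwo.add_eq_zero.1 key

include hE in
theorem char_four (x : K) : χ (x ^ 4) = χ x := by rw [← h.sq, hE, hE]

include hE in
theorem char_one : χ 1 = 1 := by
  have h1 : (1 : K) = ω + E ω := by
    rw [h.map_omega, ← add_assoc, CharTwo.add_self_eq_zero, zero_add]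
  rw [h1, AddChar.map_add_eq_mul, hE, char_mul_self]

include hE in
theorem char_eq_one_of_kerPoly {a b z : K} (hz : kerPoly E a b z = 0) :
    χ (a * (z * E z ^ 4) + b * (z * E z)) = 1 := by
  rcases eq_or_ne z 0 with rfl | h0
  · simp
  have h1 : χ (psi E a b (z * E z)) = 1 := by
    rcases (h.psi_norm_iff h0).2 hz with hp | hp <;> rw [hp]
    · exact AddChar.map_zero_eq_one χ
    · exact h.char_one hE
  rw [psi, h.kas_norm] at h1
  simp only [AddChar.map_add_eq_mul, hE, h.char_four hE] at h1
  rw [char_mul_self, one_mul] at h1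
  rw [AddChar.map_add_eq_mul, h1]

include hE hχ in
theorem quadSum_sq (a b : K) : quadSum χ E a b ^ 2 = q ^ 2 * kerCard E a b := by
  have := sq_sum_quadratic hχ (fun z => a * (z * E z ^ 4) + b * (z * E z)) (kerPoly E a b)
    (fun z => E z ^ 4) h.bijective_cube ?_
  · unfold quadSum
    rw [this, h.card, sum_congr rfl (g := fun _ => 1)]
    · simp [kerCard]
    · intro z hz
      exact h.char_eq_one_of_kerPoly hE (mem_filter.1 hz).2
  · intro z u
    -- The character is invariant under E, so each term of the polar form can be moved by powers of
    -- E until its factor in z is E(z)^4 = E³(z).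
    have e1 : χ (E z ^ 4 * kerPoly E a b u) =
        χ (a * z * E u ^ 4 + a * u * E z ^ 4 + b * z * E u + b * u * E z) := by
      have : E z ^ 4 * kerPoly E a b u = E (a * z * E u ^ 4) ^ 4 + a * u * E z ^ 4 +
          E (b * z * E u) ^ 4 + (b * u * E z) ^ 4 := by
        simp only [kerPoly, map_mul, map_pow, h.sq]
        ring
      rw [this]
      simp only [AddChar.map_add_eq_mul, h.char_four hE, hE]
    rw [e1, ← AddChar.map_add_eq_mul]
    congr 1
    simp only [map_add]
    grind

include hE hχ in
-- The square gives the value up to sign; both q and -2 are 1 modulo 3, so only the sign of q (-2)^r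
-- agrees with `quadSum_modEq`.
theorem quadSum_eq {a b : K} {r : ℕ} (hr : kerCard E a b = 4 ^ r) :
    quadSum χ E a b = q * (-2) ^ r := by
  have hs := h.quadSum_sq hχ hE a b
  obtain ⟨m, hm⟩ := h.quadSum_modEq (χ := χ) a b
  have hq : (q : ℤ) % 3 = 1 := by exact_mod_cast h.q_mod
  have h2 : (q : ℤ) * (-2) ^ r % 3 = 1 := by
    rw [Int.mul_emod, hq, one_mul]
    have : ((-2 : ℤ)) ^ r % 3 = 1 := by
      have := Int.ModEq.pow r (show (-2 : ℤ) ≡ 1 [ZMOD 3] by decide)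
      rw [one_pow] at this
      exact this
    rw [this]; rfl
  have h4 : quadSum χ E a b ^ 2 = (q * (-2) ^ r) ^ 2 := by
    rw [hs, hr, mul_pow, ← pow_mul, mul_comm r 2, pow_mul]
    norm_num
  rcases sq_eq_sq_iff_eq_or_eq_neg.1 h4 with h5 | h5
  · exact h5
  · omega

theorem kerCard_eq {g : K} (hg : ¬ ∃ c, c ^ 3 = g) (a b : K) :
    (kerCard E a b + kerCard E (a * kas E g) (b * g) +
      kerCard E (a * kas E (g ^ 2)) (b * g ^ 2) : ℤ) = 3 + 3 *
      (univ.filter fun y => y ≠ 0 ∧ (psi E a b y = 0 ∨ psi E a b y = 1)).card := by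
  have key : ∀ d, d ≠ 0 → (kerCard E (a * kas E d) (b * d) : ℤ) =
      ∑ z, (fun y => if y = 0 ∨ psi E a b y = 0 ∨ psi E a b y = 1 then (1 : ℤ) else 0)
        (d * (z * E z)) := by
    intro d hd
    rw [kerCard, card_eq_sum_ones, sum_filter]
    push_cast
    refine sum_congr rfl fun z _ => ?_
    rcases eq_or_ne z 0 with rfl | hz
    · simp [kerPoly]
    · have hz' : E z ≠ 0 := by simpa using hz
      have := h.psi_norm_iff (a := a * kas E d) (b := b * d) hz
      rw [psi_scale] at this
      simp only [mul_eq_zero, hd, hz, hz', false_or, this]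
  generalize hF : (fun y : K =>
    if y = 0 ∨ psi E a b y = 0 ∨ psi E a b y = 1 then (1 : ℤ) else 0) = F at key
  have k1 := key 1 one_ne_zero
  have hg0 : g ≠ 0 := by rintro rfl; exact hg ⟨0, by simp⟩
  simp only [kas_one, mul_one, one_mul] at k1
  rw [k1, key g hg0, key _ (pow_ne_zero 2 hg0), h.sum_norm_classes hg, ← hF,
    ← add_sum_erase univ _ (mem_univ (0 : K)), card_eq_sum_ones, sum_filter,
    ← add_sum_erase univ _ (mem_univ (0 : K))]
  simp only [true_or, if_true, ne_eq, not_true_eq_false, false_and, if_false, zero_add, mul_add,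
    mul_one]
  congr 2
  push_cast
  refine sum_congr rfl fun y hy => ?_
  have hy0 := ne_of_mem_erase hy
  simp only [hy0, false_or, not_false_eq_true, true_and]

end TwistedFrobenius

/-! ### Lines over the field with four elements and additive maps of degree 4 -/

section

variable {K : Type*} [Field K] {ω : K}

/-- The `𝔽₄`-line through `w`. -/
noncomputable def line (ω w : K) : Finset K := {0, w, ω * w, (ω + 1) * w}

theorem mem_line {w x : K} : x ∈ line ω w ↔ x = 0 ∨ x = w ∨ x = ω * w ∨ x = (ω + 1) * w := by
  simp [line]

theorem add_mul_ne_zero_of_not_mem_line [CharP K 2] {z w : K} (hz : z ∉ line ω w) :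
    z ≠ 0 ∧ z + w ≠ 0 ∧ z + ω * w ≠ 0 ∧ z + (ω + 1) * w ≠ 0 := by
  simp only [mem_line, not_or] at hz
  simpa only [ne_eq, CharTwo.add_eq_zero] using hz

variable [CharP K 2]

theorem add_pow_four (x y : K) : (x + y) ^ 4 = x ^ 4 + y ^ 4 := by grind

theorem sum_line_mul (ω x y u v : K) :
    x * y + (x + u) * (y + v) + (x + ω * u) * (y + (ω + 1) * v) +
      (x + (ω + 1) * u) * (y + ω * v) = u * v := by
  grind

theorem card_line (hω : ω ^ 2 = ω + 1) {w : K} (hw : w ≠ 0) : (line ω w).card = 4 := by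
  have h0 := omega_ne_zero hω
  have h1 : ω + 1 ≠ 0 := by rw [← hω]; exact pow_ne_zero 2 h0
  rw [line, card_insert_of_notMem, card_triple hω hw]
  simp only [mem_insert, mem_singleton, not_or]
  exact ⟨hw.symm, (mul_ne_zero h0 hw).symm, (mul_ne_zero h1 hw).symm⟩

/-- The map `z ↦ z + z ^ 4` with kernel `𝔽₄`. -/
def addFour : K →+ K where
  toFun z := z + z ^ 4
  map_zero' := by simp
  map_add' x y := by grind

/-- The map `w ↦ E a * w ^ 4 + a * w`. -/
def goldMap (E : K →+* K) (a : K) : K →+ K where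
  toFun w := E a * w ^ 4 + a * w
  map_zero' := by simp
  map_add' x y := by grind

theorem addFour_apply (z : K) : addFour z = z + z ^ 4 := rfl

theorem goldMap_apply (E : K →+* K) (a w : K) : goldMap E a w = E a * w ^ 4 + a * w := rfl

theorem addFour_omega (hω : ω ^ 2 = ω + 1) (z : K) : addFour (ω * z) = ω * addFour z := by
  simp only [addFour_apply]; grind

theorem goldMap_omega (hω : ω ^ 2 = ω + 1) (E : K →+* K) (a z : K) :
    goldMap E a (ω * z) = ω * goldMap E a z := by
  simp only [goldMap_apply]; grind

theorem kerPoly_add (E : K →+* K) (a b x y : K) :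
    kerPoly E a b (x + y) = kerPoly E a b x + kerPoly E a b y := by
  simp only [kerPoly]; grind

theorem kerPoly_omega (hω : ω ^ 2 = ω + 1) (E : K →+* K) (a b z : K) :
    kerPoly E a b (ω * z) = ω * kerPoly E a b z := by
  have h4 : ω ^ 4 = ω := by grind
  have h16 : ω ^ 16 = ω := by rw [show 16 = 4 * 4 by rfl, pow_mul, h4, h4]
  have h64 : ω ^ 64 = ω := by rw [show 64 = 16 * 4 by rfl, pow_mul, h16, h4]
  simp only [kerPoly, mul_pow, h4, h16, h64]; ring

variable [Fintype K]

theorem mem_line_iff_pow (hω : ω ^ 2 = ω + 1) {w x : K} :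
    x ∈ line ω w ↔ x = 0 ∨ x ^ 3 = w ^ 3 := by
  have := filter_cube_eq hω (z := w)
  rw [Finset.ext_iff] at this
  have := this x
  simp only [mem_filter, mem_univ, true_and, mem_insert, mem_singleton] at this
  rw [mem_line, this]

/-- The preimage of a line under an `𝔽₄`-linear map. -/
theorem card_preimage_line (hω : ω ^ 2 = ω + 1) (f : K →+ K) (hf : ∀ z, f (ω * z) = ω * f z)
    {w : K} (hw : w ≠ 0) :
    (univ.filter fun z => f z ∈ line ω w).card =
      (univ.filter fun z => f z = 0).card * if ∃ z, f z = w then 4 else 1 := by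
  have hf2 : ∀ z, f ((ω + 1) * z) = (ω + 1) * f z := by
    intro z; rw [add_mul, map_add, hf, one_mul]; ring
  have hwz : ω * (ω + 1) = 1 := by
    have : ω * (ω + 1) = ω ^ 2 + ω := by ring
    rw [this, hω, add_right_comm, CharTwo.add_self_eq_zero, zero_add]
  split_ifs with hz
  · obtain ⟨z₀, hz₀⟩ := hz
    have hfib : ∀ c ∈ line ω w, (univ.filter fun z => f z = c).card =
        (univ.filter fun z => f z = 0).card := by
      intro c hc
      have : ∃ y, f y = c := by
        rcases mem_line.1 hc with rfl | rfl | rfl | rfl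
        · exact ⟨0, map_zero f⟩
        · exact ⟨z₀, hz₀⟩
        · exact ⟨ω * z₀, by rw [hf, hz₀]⟩
        · exact ⟨(ω + 1) * z₀, by rw [hf2, hz₀]⟩
      obtain ⟨y, rfl⟩ := this
      refine card_bij' (fun z _ => z - y) (fun z _ => z + y) ?_ ?_ ?_ ?_ <;> simp
      · intro z hz; rw [hz, sub_self]
    rw [card_eq_sum_card_fiberwise (f := f) (t := line ω w)]
    · rw [sum_congr rfl (g := fun _ => (univ.filter fun z => f z = 0).card)]
      · rw [sum_const, card_line hω hw, smul_eq_mul, mul_comm]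
      · intro c hc
        rw [← hfib c hc]
        congr 1
        ext z
        simp only [mem_filter, mem_univ, true_and, and_iff_right_iff_imp]
        rintro rfl; exact hc
    · intro z hz
      simpa using hz
  · rw [mul_one]
    congr 1
    ext z
    simp only [mem_filter, mem_univ, true_and]
    constructor
    · intro h
      rcases mem_line.1 h with h | h | h | h
      · exact h
      · exact (hz ⟨z, h⟩).elim
      · exact (hz ⟨(ω + 1) * z, by rw [hf2, h, ← mul_assoc, mul_comm (ω + 1), hwz, one_mul]⟩).elim
      · exact (hz ⟨ω * z, by rw [hf, h, ← mul_assoc, hwz, one_mul]⟩).elim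
    · intro h
      rw [h]; simp [line]

end

/-! ### Counting radicals -/

namespace TwistedFrobenius

variable {K : Type*} [Field K] [Fintype K] [CharP K 2] {E : K →+* K} {ω : K} {q : ℕ}
  (h : TwistedFrobenius E ω q)

include h

/-- For w ≠ 0, w is a zero exactly when d w E(w) is fixed by E; being nonzero, it must then be 1. -/
theorem goldMap_eq_zero_iff {d w : K} (hd : d ≠ 0) :
    goldMap E d w = 0 ↔ w = 0 ∨ w * E w = d⁻¹ := by
  rcases eq_or_ne w 0 with rfl | hw
  · simp
  have hw' : E w ≠ 0 := by simpa using hw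
  have key : E (d * (w * E w)) + d * (w * E w) = E w * goldMap E d w := by
    simp only [goldMap_apply, map_mul, h.sq]; ring
  simp only [hw, false_or]
  rw [← mul_eq_one_iff_eq_inv₀ hd, mul_comm (w * E w)]
  constructor
  · intro h0
    rw [h0, mul_zero, CharTwo.add_eq_zero] at key
    exact (h.eq_of_fixed key).resolve_left (mul_ne_zero hd (mul_ne_zero hw hw'))
  · intro h1
    rw [h1, map_one, CharTwo.add_self_eq_zero] at key
    exact (mul_eq_zero.1 key.symm).resolve_left hw'

theorem card_goldMap {d : K} (hd : d ≠ 0) :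
    (univ.filter fun w => goldMap E d w = 0).card = if ∃ c, c ^ 3 = d then 4 else 1 := by
  have : (univ.filter fun w => goldMap E d w = 0) =
      insert 0 (univ.filter fun w => w * E w = d⁻¹) := by
    ext w; simp [h.goldMap_eq_zero_iff hd]
  rw [this, card_insert_of_notMem, h.card_norm_fiber (inv_ne_zero hd)]
  · have : (∃ c, c ^ 3 = d⁻¹) ↔ ∃ c, c ^ 3 = d :=
      ⟨fun hc => by simpa only [inv_inv] using cube_inv hc, cube_inv⟩
    simp only [this]
    split_ifs <;> rfl
  · simpa using hd.symm

theorem goldMap_injective {d : K} (hd : ¬ ∃ c, c ^ 3 = d) : Function.Injective (goldMap E d) := by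
  have hd0 : d ≠ 0 := by rintro rfl; exact hd ⟨0, by simp⟩
  rw [injective_iff_map_eq_zero]
  intro w hw
  have h1 := h.card_goldMap hd0
  rw [if_neg hd, card_eq_one] at h1
  obtain ⟨x, hx⟩ := h1
  have e1 : w ∈ ({x} : Finset K) := by rw [← hx]; simp [hw]
  have e2 : (0 : K) ∈ ({x} : Finset K) := by rw [← hx]; simp
  rw [mem_singleton] at e1 e2
  rw [e1, e2]

theorem card_addFour : (univ.filter fun z : K => addFour z = 0).card = 4 := by
  have := h.card_goldMap (one_ne_zero (α := K))
  rw [if_pos ⟨1, by simp⟩] at this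
  rw [← this]
  refine congrArg Finset.card (filter_congr fun z _ => ?_)
  simp only [addFour_apply, goldMap_apply, map_one, one_mul, add_comm]

/-! ### The radical when `psi` vanishes at `1` -/

section Isotropic

variable {a b : K} (ha : a ≠ 0) (hb : b ^ 4 = a ^ 4 + E a + a)

include ha hb

/-- The radical for a class of noncubes. -/
theorem kerCard_noncube {g : K} (hg : ¬ ∃ c, c ^ 3 = g) :
    kerCard E (a * kas E g) (b * g) = if ∃ c, c ^ 3 = a * g then 4 else 1 := by
  have hg0 : g ≠ 0 := by rintro rfl; exact hg ⟨0, by simp⟩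
  have hEg : E g ≠ 0 := by simpa using hg0
  have hb' : E b ^ 4 = E a ^ 4 + a ^ 4 + E a := by
    rw [← map_pow, hb]; simp only [map_add, map_pow, h.sq]
  have hinj := h.goldMap_injective hg
  -- The relation between a and b makes the radical polynomial a composite of three Gold maps. The
  -- outer two belong to the noncube g and are injective, so the middle one, with coefficient a g,
  -- decides.
  have key : ∀ z, E g * kerPoly E (a * kas E g) (b * g) z =
      goldMap E g (g⁻¹ * goldMap E (a * g) (g⁻¹ * goldMap E g z)) * g ^ 4 := by
    intro z
    have hP : goldMap E (a * g) (g⁻¹ * goldMap E g z) =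
        E a * (E g ^ 5 / g ^ 4) * z ^ 16 + (E a + a) * E g * z ^ 4 + a * g * z := by
      simp only [goldMap_apply, mul_pow, add_pow_four, map_mul]
      field_simp
      ring
    rw [hP, goldMap_apply]
    simp only [kerPoly, kas, map_mul, map_div₀, map_pow, h.sq, mul_pow, div_pow, hb, hb',
      add_pow_four]
    field_simp
    ring
  have hiff : ∀ z, kerPoly E (a * kas E g) (b * g) z = 0 ↔
      goldMap E (a * g) (g⁻¹ * goldMap E g z) = 0 := by
    intro z
    have h1 : kerPoly E (a * kas E g) (b * g) z = 0 ↔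
        E g * kerPoly E (a * kas E g) (b * g) z = 0 := by simp [hg0]
    rw [h1, key z, mul_eq_zero, or_iff_left (pow_ne_zero 4 hg0),
      map_eq_zero_iff _ hinj, mul_eq_zero, or_iff_right (inv_ne_zero hg0)]
  rw [← h.card_goldMap (mul_ne_zero ha hg0), kerCard]
  have hbij : Function.Bijective fun z => g⁻¹ * goldMap E g z := by
    refine Finite.injective_iff_bijective.1 fun x y hxy => hinj ?_
    exact mul_left_cancel₀ (inv_ne_zero hg0) hxy
  refine card_bij (fun z _ => g⁻¹ * goldMap E g z) ?_ ?_ ?_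
  · intro z hz
    simpa [hiff] using hz
  · intro x _ y _ hxy
    exact hbij.1 hxy
  · intro w hw
    obtain ⟨z, rfl⟩ := hbij.2 w
    exact ⟨z, by simpa [hiff] using hw, rfl⟩

omit ha in
theorem kerPoly_eq_goldMap (z : K) :
    kerPoly E a b z = goldMap E a (addFour z) ^ 4 + goldMap E a (addFour z) := by
  have hb' : E b ^ 4 = E a ^ 4 + a ^ 4 + E a := by
    rw [← map_pow, hb]; simp only [map_add, map_pow, h.sq]
  simp only [kerPoly, goldMap_apply, addFour_apply, hb, hb']
  grind

omit ha in
theorem kerPoly_eq_zero_iff (z : K) :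
    kerPoly E a b z = 0 ↔ goldMap E a (addFour z) ∈ line ω 1 := by
  rw [h.kerPoly_eq_goldMap hb, mem_line_iff_pow h.omega_sq, one_pow]
  generalize goldMap E a (addFour z) = x
  constructor
  · intro hx
    have : x * (x ^ 3 - 1) = 0 := by grind
    rcases mul_eq_zero.1 this with h0 | h0
    · exact Or.inl h0
    · exact Or.inr (sub_eq_zero.1 h0)
  · rintro (rfl | hx)
    · simp
    · grind

omit ha in
theorem kerCard_eq_mul : kerCard E a b =
    (univ.filter fun z => goldMap E a (addFour z) = 0).card *
      if ∃ z, goldMap E a (addFour z) = 1 then 4 else 1 := by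
  have := card_preimage_line h.omega_sq ((goldMap E a).comp addFour)
    (fun z => by simp [addFour_omega h.omega_sq, goldMap_omega h.omega_sq]) (one_ne_zero (α := K))
  simp only [kerCard, h.kerPoly_eq_zero_iff hb]
  exact this

omit ha hb in
theorem card_goldMap_addFour_noncube (hc : ¬ ∃ c, c ^ 3 = a) :
    (univ.filter fun z => goldMap E a (addFour z) = 0).card = 4 := by
  simp only [map_eq_zero_iff _ (h.goldMap_injective hc)]
  exact h.card_addFour

omit hb in
theorem card_goldMap_addFour_cube {w : K} (hw : a * (w * E w) = 1) :
    (univ.filter fun z => goldMap E a (addFour z) = 0).card =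
      4 * if ∃ z, addFour z = w then 4 else 1 := by
  have hw0 : w ≠ 0 := by rintro rfl; simp at hw
  have hEw : E w ≠ 0 := by simpa using hw0
  have hc := card_preimage_line h.omega_sq addFour (addFour_omega h.omega_sq) hw0
  rw [h.card_addFour] at hc
  rw [← hc]
  congr 1
  ext z
  simp only [mem_filter, mem_univ, true_and]
  rw [h.goldMap_eq_zero_iff ha, mem_line_iff_pow h.omega_sq, ← eq_inv_of_mul_eq_one_right hw]
  have := h.cube_eq_one_iff (x := addFour z / w)
  rw [map_div₀, div_pow, div_mul_div_comm, div_eq_one_iff_eq (mul_ne_zero hw0 hEw),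
    div_eq_one_iff_eq (pow_ne_zero 3 hw0)] at this
  rw [this]

omit ha in
theorem kerCard_self_noncube (hc : ¬ ∃ c, c ^ 3 = a) :
    kerCard E a b = if ∃ z, goldMap E a (addFour z) = 1 then 4 ^ 2 else 4 ^ 1 := by
  rw [h.kerCard_eq_mul hb, h.card_goldMap_addFour_noncube hc]
  split_ifs <;> rfl

omit hb in
theorem exists_norm_inv (hc : ∃ c, c ^ 3 = a) : ∃ w, a * (w * E w) = 1 := by
  obtain ⟨c, rfl⟩ := hc
  have hc0 : c ≠ 0 := by rintro rfl; simp at ha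
  obtain ⟨w, hw⟩ := h.exists_norm_eq (inv_ne_zero hc0)
  exact ⟨w, by rw [hw, inv_pow, mul_inv_cancel₀ ha]⟩

theorem kerCard_self_cube (hc : ∃ c, c ^ 3 = a) :
    kerCard E a b = 4 ^ 1 ∨ kerCard E a b = 4 ^ 2 ∨ kerCard E a b = 4 ^ 3 := by
  obtain ⟨w, hw⟩ := h.exists_norm_inv ha hc
  rw [h.kerCard_eq_mul hb, h.card_goldMap_addFour_cube ha hw]
  split_ifs <;> norm_num

/-- If 1 were of the form goldMap(addFour z), then w would lie in the range of `addFour`. Hence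
neither factor of 4 beyond the kernel of `addFour` appears. -/
theorem kerCard_self_of_not_mem {w : K} (hw : a * (w * E w) = 1) (hn : ¬ ∃ z, addFour z = w) :
    kerCard E a b = 4 := by
  have hw0 : w ≠ 0 := by rintro rfl; simp at hw
  have hEw : E w ≠ 0 := by simpa using hw0
  rw [h.kerCard_eq_mul hb, h.card_goldMap_addFour_cube ha hw, if_neg hn, if_neg]
  rintro ⟨z, hz⟩
  apply hn
  -- Dividing the equation by w shows addFour(addFour z / w) = E w. Applying E gives w^4 = w +
  -- addFour w in the range, which yields this preimage of w.
  refine ⟨w + E (addFour z / w), ?_⟩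
  have hEa : E a * (E w * w ^ 4) = 1 := by
    have := congrArg E hw
    simpa only [map_mul, h.sq, map_one] using this
  rw [goldMap_apply] at hz
  have h1 : addFour (addFour z / w) = E w := by
    rw [addFour_apply (_ / _)]
    have h2 : E a = (E w * w ^ 4)⁻¹ := eq_inv_of_mul_eq_one_left hEa
    have h3 : a = (w * E w)⁻¹ := eq_inv_of_mul_eq_one_left hw
    rw [h2, h3] at hz
    field_simp at hz ⊢
    linear_combination hz
  have h4 : addFour (E (addFour z / w)) = w ^ 4 := by
    rw [addFour_apply (E _), ← map_pow, ← map_add, ← addFour_apply (_ / _), h1, h.sq]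
  rw [map_add, h4, addFour_apply w, add_assoc, CharTwo.add_self_eq_zero, add_zero]

end Isotropic

/-- The form `z ↦ psi (z * E z)` on a line which does not pass through `0`. -/
theorem sum_psi_line (a b z w : K) :
    psi E a b (z * E z) + psi E a b ((z + w) * E (z + w)) +
      psi E a b ((z + ω * w) * E (z + ω * w)) +
      psi E a b ((z + (ω + 1) * w) * E (z + (ω + 1) * w)) = psi E a b (w * E w) := by
  have hω4 : ω ^ 4 = ω := by have := h.omega_sq; grind
  have e1 : ω + 1 + 1 = ω := by rw [add_assoc, CharTwo.add_self_eq_zero, add_zero]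
  simp only [psi, h.kas_norm]
  simp only [map_mul, map_add, map_pow, h.sq, h.map_omega, map_one, mul_pow,
    add_pow_four, hω4, one_pow, ← pow_mul, Nat.reduceMul, e1]
  linear_combination a ^ 4 * sum_line_mul ω (z ^ 4) (E z ^ 16) (w ^ 4) (E w ^ 16) +
    E a * sum_line_mul ω (z ^ 16) (E z) (w ^ 16) (E w) +
    a * sum_line_mul ω z (E z ^ 4) w (E w ^ 4) +
    b ^ 4 * sum_line_mul ω (z ^ 4) (E z ^ 4) (w ^ 4) (E w ^ 4)

/-- Without zeros of `psi` the radical is at most a line. -/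
theorem kerCard_of_anisotropic {a b : K} (hn : ∀ y, y ≠ 0 → psi E a b y ≠ 0) :
    kerCard E a b = 4 ^ 0 ∨ kerCard E a b = 4 ^ 1 := by
  by_cases hz : ∃ z, z ≠ 0 ∧ kerPoly E a b z = 0
  · right
    obtain ⟨w, hw0, hw⟩ := hz
    rw [kerCard, pow_one, ← card_line h.omega_sq hw0]
    congr 1
    ext z
    simp only [mem_filter, mem_univ, true_and]
    have hω := kerPoly_omega h.omega_sq E a b
    have hω2 : ∀ z, kerPoly E a b ((ω + 1) * z) = (ω + 1) * kerPoly E a b z := by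
      intro z; rw [add_mul, kerPoly_add, hω, one_mul]; ring
    constructor
    · intro hz
      by_contra hl
      obtain ⟨n1, n2, n3, n4⟩ := add_mul_ne_zero_of_not_mem_line hl
      have one : ∀ x, x ≠ 0 → kerPoly E a b x = 0 → psi E a b (x * E x) = 1 := by
        intro x hx hk
        refine ((h.psi_norm_iff hx).2 hk).resolve_left (hn _ ?_)
        simpa using hx
      have p1 := one z n1 hz
      have p2 := one _ n2 (by rw [kerPoly_add, hz, hw, add_zero])
      have p3 := one _ n3 (by rw [kerPoly_add, hω, hz, hw, mul_zero, add_zero])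
      have p4 := one _ n4 (by rw [kerPoly_add, hω2, hz, hw, mul_zero, add_zero])
      have p5 := one w hw0 hw
      -- The four values 1 on the affine line sum to 0, whereas the value at the direction w is 1.
      have this := h.sum_psi_line a b z w
      rw [p1, p2, p3, p4, p5, CharTwo.add_self_eq_zero, zero_add, CharTwo.add_self_eq_zero] at this
      exact zero_ne_one this
    · intro hz
      rcases mem_line.1 hz with rfl | rfl | rfl | rfl
      · simp [kerPoly]
      · exact hw
      · rw [hω, hw, mul_zero]
      · rw [hω2, hw, mul_zero]
  · left
    rw [kerCard, pow_zero, card_eq_one]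
    refine ⟨0, ?_⟩
    ext z
    simp only [mem_filter, mem_univ, true_and, mem_singleton]
    constructor
    · intro h1
      by_contra h0
      exact hz ⟨z, h0, h1⟩
    · rintro rfl
      simp [kerPoly]

end TwistedFrobenius

/-! ### Fourier identities and the counts of values of psi -/

section

variable {K : Type*} [Field K] [Fintype K] {χ : AddChar K ℤ}

/-- Parseval's identity for the Fourier transform over a field of characteristic two. -/
theorem sum_sq_fourier [CharP K 2] (hχ : χ.IsPrimitive) (G : K → ℤ) :
    ∑ b, (∑ y, G y * χ (b * y)) ^ 2 = Fintype.card K * ∑ y, G y ^ 2 := by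
  have h1 : ∀ b, (∑ y, G y * χ (b * y)) ^ 2 =
      ∑ y, ∑ y', G y * G y' * χ (b * (y + y')) := by
    intro b
    rw [sq, sum_mul_sum]
    refine sum_congr rfl fun y _ => sum_congr rfl fun y' _ => ?_
    rw [mul_add, AddChar.map_add_eq_mul]
    ring
  simp only [h1]
  rw [sum_comm, mul_sum]
  refine sum_congr rfl fun y _ => ?_
  rw [sum_comm]
  simp only [← mul_sum, AddChar.sum_mulShift _ hχ, CharTwo.add_eq_zero]
  rw [sum_eq_single y]
  · simp; ring
  · intro y' _ hy'
    simp [hy'.symm]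
  · simp

theorem sum_fourier (hχ : χ.IsPrimitive) (G : K → ℤ) :
    ∑ b, ∑ y, G y * χ (b * y) = Fintype.card K * G 0 := by
  rw [sum_comm]
  simp only [← mul_sum, AddChar.sum_mulShift _ hχ]
  rw [sum_eq_single 0]
  · simp [mul_comm]
  · intro y _ hy
    simp [hy]
  · simp

theorem kerCard_pos (E : K →+* K) (a b : K) : 0 < kerCard E a b := by
  refine card_pos.2 ⟨0, ?_⟩
  rw [mem_filter]
  simp [kerPoly]

/-- The number of nonzero points at which `psi` takes a given value. -/
noncomputable def psiCard (E : K →+* K) (a b ε : K) : ℕ :=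
  (univ.filter fun y => y ≠ 0 ∧ psi E a b y = ε).card

theorem psiCard_scale (E : K →+* K) (a b ε : K) {x : K} (hx : x ≠ 0) :
    psiCard E (a * kas E x) (b * x) ε = psiCard E a b ε := by
  refine card_bij (fun y _ => x * y) ?_ ?_ ?_
  · intro y hy
    simpa [psi_scale, hx] using hy
  · intro y _ y' _ hyy
    exact mul_left_cancel₀ hx hyy
  · intro y hy
    refine ⟨x⁻¹ * y, ?_, mul_inv_cancel_left₀ hx y⟩
    simpa [psi_scale, hx] using hy

end

section

variable {K : Type*} [Field K]

theorem psi_one [CharP K 2] {E : K →+* K} {a b : K} :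
    psi E a b 1 = 0 ↔ b ^ 4 = a ^ 4 + E a + a := by
  rw [psi, kas_one, mul_one, mul_one, CharTwo.add_eq_zero, eq_comm]

theorem kas_mul_inv {E : K →+* K} {x : K} (hx : x ≠ 0) (a : K) :
    a * kas E x * kas E x⁻¹ = a := by
  rw [mul_assoc, ← kas_mul, mul_inv_cancel₀ hx, kas_one, mul_one]

end

namespace TwistedFrobenius

variable {K : Type*} [Field K] [Fintype K] [CharP K 2] {E : K →+* K} {ω : K} {q : ℕ}
  (h : TwistedFrobenius E ω q)

include h

theorem q_pos : 0 < q := by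
  have := h.q_mod
  omega

theorem exists_noncube : ∃ g : K, ¬ ∃ c, c ^ 3 = g := by
  by_contra! hc
  have hs : Function.Surjective fun x : K => x ^ 3 := hc
  have hi := Finite.injective_iff_surjective.2 hs
  have h1 : ω = 1 := hi (by have := h.omega_sq; simp only; grind)
  exact omega_ne_one h.omega_sq h1

/-- The parameter b enters `psi` only through (b y)^4 = E(E(b y)). Thus every y ≠ 0 meets each value
for exactly one b, which makes the totals over b equal for all values. -/
theorem injective_psi (a : K) {y : K} (hy : y ≠ 0) : Function.Injective fun b => psi E a b y := by
  intro b b' hb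
  have h4 : E (E (b * y)) = E (E (b' * y)) := by
    rw [h.sq, h.sq]; exact add_left_cancel hb
  exact mul_right_cancel₀ hy (E.injective (E.injective h4))

theorem exists_psi_eq (a ε : K) {y : K} (hy : y ≠ 0) : ∃ b, psi E a b y = ε :=
  Finite.injective_iff_surjective.1 (h.injective_psi a hy) ε

theorem sum_psiCard (a ε : K) : ∑ b, psiCard E a b ε = Fintype.card K - 1 := by
  simp only [psiCard, card_eq_sum_ones, sum_filter]
  rw [sum_comm, ← Finset.card_univ, ← card_erase_of_mem (mem_univ (0 : K)), card_eq_sum_ones,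
    ← add_sum_erase univ _ (mem_univ (0 : K))]
  simp only [ne_eq, not_true_eq_false, false_and, if_false, sum_const_zero, zero_add]
  refine sum_congr rfl fun y hy => ?_
  have hy0 := ne_of_mem_erase hy
  obtain ⟨b₀, hb₀⟩ := h.exists_psi_eq a ε hy0
  rw [sum_eq_single b₀]
  · simp [hy0, hb₀]
  · intro b _ hb
    rw [if_neg]
    rintro ⟨-, h1⟩
    exact hb (h.injective_psi a hy0 (h1.trans hb₀.symm))
  · simp

theorem kerCard_sum {g : K} (hg : ¬ ∃ c, c ^ 3 = g) (a b : K) :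
    kerCard E a b + kerCard E (a * kas E g) (b * g) + kerCard E (a * kas E (g ^ 2)) (b * g ^ 2) =
      3 + 3 * (psiCard E a b 0 + psiCard E a b 1) := by
  have := h.kerCard_eq hg a b
  have h2 : (univ.filter fun y => y ≠ 0 ∧ (psi E a b y = 0 ∨ psi E a b y = 1)).card =
      psiCard E a b 0 + psiCard E a b 1 := by
    simp only [and_or_left, filter_or, psiCard]
    rw [card_union_of_disjoint]
    rw [disjoint_filter]
    rintro y - ⟨-, h0⟩ ⟨-, h1⟩
    exact zero_ne_one (h0.symm.trans h1)
  rw [h2] at this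
  exact_mod_cast this

theorem cube_mul_kas_iff {a y : K} (hy : y ≠ 0) :
    (∃ c, c ^ 3 = a * kas E y) ↔ ∃ c, c ^ 3 = a := by
  constructor
  · intro hc
    exact cube_of_mul (by rwa [mul_comm] at hc) (h.kas_cube y) (kas_ne_zero hy)
  · intro hc
    exact cube_mul hc (h.kas_cube y)

variable {χ : AddChar K ℤ} (hχ : χ.IsPrimitive) (hE : ∀ x, χ (E x) = χ x)

include hχ hE in
theorem three_mul_kasSum_eq {g : K} (hg : ¬ ∃ c, c ^ 3 = g) {a b : K} {r s t : ℕ}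
    (hr : kerCard E a b = 4 ^ r) (hs : kerCard E (a * kas E g) (b * g) = 4 ^ s)
    (ht : kerCard E (a * kas E (g ^ 2)) (b * g ^ 2) = 4 ^ t) :
    3 * kasSum χ E a b = q * ((-2) ^ r + (-2) ^ s + (-2) ^ t) := by
  rw [h.three_mul_kasSum hg, h.quadSum_eq hχ hE hr, h.quadSum_eq hχ hE hs, h.quadSum_eq hχ hE ht]
  ring

include hχ in
theorem sum_kasSum_sq (a : K) : ∑ b, kasSum χ E a b ^ 2 = q ^ 4 := by
  have := sum_sq_fourier hχ fun y => χ (a * kas E y)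
  simp only [_root_.sq (χ _), char_mul_self, sum_const, Finset.card_univ, nsmul_eq_mul, mul_one,
    h.card] at this
  simp only [kasSum, AddChar.map_add_eq_mul]
  rw [this]
  push_cast
  ring

/-! ### Noncubes -/

section Noncube

variable {a b : K} (ha : ¬ ∃ c, c ^ 3 = a)

include ha

/-- The noncube a itself represents the other classes: a · a is a noncube and a · a^2 is a cube. -/
theorem kerCard_noncube_classes (hb : psi E a b 1 = 0) :
    (kerCard E a b = 4 ^ 1 ∨
      kerCard E a b = 4 ^ 2 ∧ ∃ z, goldMap E a (addFour z) = 1) ∧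
    kerCard E (a * kas E a) (b * a) = 4 ^ 0 ∧ kerCard E (a * kas E (a ^ 2)) (b * a ^ 2) = 4 ^ 1 := by
  have ha0 : a ≠ 0 := by rintro rfl; exact ha ⟨0, by simp⟩
  rw [psi_one] at hb
  refine ⟨?_, ?_, ?_⟩
  · have := h.kerCard_self_noncube hb ha
    split_ifs at this with hz
    · exact Or.inr ⟨this, hz⟩
    · exact Or.inl this
  · rw [h.kerCard_noncube ha0 hb ha, if_neg, pow_zero]
    rw [← _root_.sq]
    exact fun hc => ha (cube_of_sq hc)
  · rw [h.kerCard_noncube ha0 hb fun hc => ha (cube_of_sq hc), if_pos, pow_one]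
    exact ⟨a, by ring⟩

/-- The radical of the class of a^2 has a nonzero point, which lies over some y in that class. The
value 0 at y is excluded by recentring there. -/
theorem exists_psi_eq_one (hb : psi E a b 1 = 0) :
    ∃ y, (y ≠ 0 ∧ psi E a b y = 1) ∧ ¬ ∃ c, c ^ 3 = y := by
  have ha0 : a ≠ 0 := by rintro rfl; exact ha ⟨0, by simp⟩
  have ha2 : ¬ ∃ c, c ^ 3 = a ^ 2 := fun hc => ha (cube_of_sq hc)
  obtain ⟨hk, -, hk2⟩ := h.kerCard_noncube_classes ha hb
  have hlt : 1 < kerCard E (a * kas E (a ^ 2)) (b * a ^ 2) := by rw [hk2]; norm_num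
  obtain ⟨z, hz, hz0⟩ := exists_mem_ne hlt 0
  have hz := (mem_filter.1 hz).2
  have hEz : E z ≠ 0 := by simpa using hz0
  have hn0 := mul_ne_zero hz0 hEz
  obtain ⟨d, hd⟩ := h.norm_cube z
  have hp := (h.psi_norm_iff hz0).2 hz
  rw [psi_scale] at hp
  have hy0 : a ^ 2 * (z * E z) ≠ 0 := mul_ne_zero (pow_ne_zero 2 ha0) hn0
  refine ⟨a ^ 2 * (z * E z), ⟨hy0, hp.resolve_left fun h0 => ?_⟩, fun hc => ha2 ?_⟩
  -- Were y a zero, it could serve as base point. The original base point would then lie in the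
  -- class of 1/y, where the product a · kas(y) / y is a noncube, so its radical would be trivial;
  -- but it has order at least 4.
  · generalize hy : a ^ 2 * (z * E z) = y at h0 hy0
    have hinv : ¬ ∃ c, c ^ 3 = y⁻¹ := by
      intro hc
      have := cube_inv hc
      rw [inv_inv, ← hy, mul_comm] at this
      exact ha2 (cube_of_mul this ⟨d, hd.symm⟩ hn0)
    have hn : ¬ ∃ c, c ^ 3 = a * kas E y * y⁻¹ := by
      rw [mul_right_comm, h.cube_mul_kas_iff hy0]
      rintro ⟨c, hc⟩
      apply ha
      refine cube_of_sq ⟨c * a * d, ?_⟩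
      rw [mul_pow, mul_pow, hc, ← hd, ← hy]
      field_simp
    have hb1 : psi E (a * kas E y) (b * y) 1 = 0 := by rw [psi_scale, mul_one, h0]
    have h1 := h.kerCard_noncube (mul_ne_zero ha0 (kas_ne_zero hy0)) (psi_one.1 hb1) hinv
    rw [kas_mul_inv hy0, mul_inv_cancel_right₀ hy0, if_neg hn] at h1
    omega
  · rw [mul_comm] at hc
    exact cube_of_mul hc ⟨d, hd.symm⟩ hn0

omit ha in
/-- The quadratic form on the translates by `𝔽₄`. -/
theorem psi_translate (hb : psi E a b 1 = 0) {c : K} (hc : c ^ 3 = 1) (z : K) :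
    psi E a b ((z + c) * E (z + c)) = psi E a b (z * E z) +
      (c ^ 2 * goldMap E a (addFour z) + c * E (goldMap E a (addFour z))) := by
  rw [psi_one] at hb
  have hEc : E c = c ^ 2 := by
    have h1 := h.cube_eq_one_iff.2 hc
    have hc0 : c ≠ 0 := by rintro rfl; simp at hc
    apply mul_left_cancel₀ hc0
    rw [h1, ← hc]; ring
  have hc4 : c ^ 4 = c := by rw [pow_succ, hc, one_mul]
  have hc8 : (c ^ 2) ^ 4 = c ^ 2 := by rw [← pow_mul, mul_comm, pow_mul, hc4]
  simp only [psi, h.kas_norm]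
  simp only [goldMap_apply, addFour_apply, map_mul, map_add, map_pow, h.sq, hEc, mul_pow,
    add_pow_four, hb, hc4, hc8]
  have hc6 : c * c ^ 2 = 1 := by rw [← hc]; ring
  grind

omit ha in
-- By `psi_translate`, if goldMap(addFour z) = ω then translating z by 1 flips `psi`, since ω + E(ω)
-- = 1, and translating by ω preserves it. So some z and z + ω both give the value 1.
theorem two_le_psiCard (hb : psi E a b 1 = 0) (hz : ∃ z, goldMap E a (addFour z) = 1) :
    ∃ y y', y ≠ y' ∧ ((y ≠ 0 ∧ psi E a b y = 1) ∧ ∃ c, c ^ 3 = y) ∧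
      ((y' ≠ 0 ∧ psi E a b y' = 1) ∧ ∃ c, c ^ 3 = y') := by
  have ho := h.omega_sq
  have hm := h.map_omega
  have ho3 : ω ^ 3 = 1 := by grind
  have key : ∀ z, goldMap E a (addFour z) = ω → psi E a b (z * E z) = 1 →
      ∃ y y', y ≠ y' ∧ ((y ≠ 0 ∧ psi E a b y = 1) ∧ ∃ c, c ^ 3 = y) ∧
        ((y' ≠ 0 ∧ psi E a b y' = 1) ∧ ∃ c, c ^ 3 = y') := by
    intro z hz hp
    have hnz : addFour z ≠ 0 := by
      intro h0
      rw [h0, map_zero] at hz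
      exact omega_ne_zero ho hz.symm
    rw [addFour_apply] at hnz
    have hne : ∀ x : K, x + x ^ 4 ≠ 0 → x * E x ≠ 0 := by
      intro x hx h0
      rcases mul_eq_zero.1 h0 with h1 | h1
      · exact hx (by rw [h1]; simp)
      · exact hx (by rw [(map_eq_zero E).1 h1]; simp)
    have hz2 : (z + ω) + (z + ω) ^ 4 ≠ 0 := by
      have : (z + ω) + (z + ω) ^ 4 = z + z ^ 4 := by grind
      rwa [this]
    refine ⟨z * E z, (z + ω) * E (z + ω), ?_, ⟨⟨hne _ hnz, hp⟩, ?_⟩, ⟨⟨hne _ hz2, ?_⟩, ?_⟩⟩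
    · intro he
      rw [map_add, hm] at he
      -- Equal norms at z and z + ω determine E(z); applying E once more gives z^4 = z, contrary to
      -- addFour z ≠ 0.
      have h1 : E z = z * ω + ω + 1 := by grind
      have h2 : z ^ 4 = E z * (ω + 1) + ω := by
        rw [← h.sq, h1]; simp only [map_add, map_mul, hm, map_one]; grind
      apply hnz
      rw [h2, h1]; grind
    · obtain ⟨c, hc⟩ := h.norm_cube z
      exact ⟨c, hc.symm⟩
    · rw [h.psi_translate hb ho3, hp, hz, hm]; grind
    · obtain ⟨c, hc⟩ := h.norm_cube (z + ω)
      exact ⟨c, hc.symm⟩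
  obtain ⟨z₁, hz₁⟩ := hz
  have hz : goldMap E a (addFour (ω * z₁)) = ω := by
    rw [addFour_omega ho, goldMap_omega ho, hz₁, mul_one]
  generalize ω * z₁ = z at hz
  have hz0 : z ≠ 0 := by
    rintro rfl
    rw [map_zero, map_zero] at hz
    exact omega_ne_zero ho hz.symm
  have hk : kerPoly E a b z = 0 := by
    rw [h.kerPoly_eq_zero_iff (psi_one.1 hb), hz, mem_line]; simp
  rcases (h.psi_norm_iff hz0).2 hk with hp | hp
  · refine key (z + 1) ?_ ?_
    · rw [map_add, addFour_apply 1, one_pow, CharTwo.add_self_eq_zero, add_zero, hz]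
    · rw [h.psi_translate hb (one_pow 3), hp, hz, hm]; grind
  · exact key z hz hp

/-- The radical orders sum to 9 or 21, so the two counts add up to 2 or 6. One noncube point with
value 1 suffices in the first case; together with the two cube points it gives three in the second.
-/
theorem psiCard_le_of_psi_one (hb : psi E a b 1 = 0) : psiCard E a b 0 ≤ psiCard E a b 1 := by
  have hsum := h.kerCard_sum ha a b
  obtain ⟨y, hy, hyc⟩ := h.exists_psi_eq_one ha hb
  obtain ⟨hk, hk1, hk2⟩ := h.kerCard_noncube_classes ha hb
  rw [hk1, hk2] at hsum
  rcases hk with hk | ⟨hk, hz⟩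
  · rw [hk] at hsum
    have : 0 < psiCard E a b 1 := card_pos.2 ⟨y, by simpa using hy⟩
    omega
  · rw [hk] at hsum
    obtain ⟨y₁, y₂, hne, ⟨h1, hc1⟩, ⟨h2, hc2⟩⟩ := h.two_le_psiCard hb hz
    have : 3 ≤ psiCard E a b 1 := by
      have h3 : ({y, y₁, y₂} : Finset K).card = 3 := by
        rw [card_eq_three]
        refine ⟨y, y₁, y₂, ?_, ?_, hne, rfl⟩
        · rintro rfl; exact hyc hc1
        · rintro rfl; exact hyc hc2
      rw [← h3]
      refine card_le_card ?_
      intro x hx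
      simp only [mem_insert, mem_singleton] at hx
      rw [mem_filter]
      rcases hx with rfl | rfl | rfl
      exacts [⟨mem_univ _, hy⟩, ⟨mem_univ _, h1⟩, ⟨mem_univ _, h2⟩]
    omega

theorem psiCard_le (b : K) : psiCard E a b 0 ≤ psiCard E a b 1 := by
  by_cases hy : ∃ y, y ≠ 0 ∧ psi E a b y = 0
  · obtain ⟨y, hy0, hy⟩ := hy
    rw [← psiCard_scale E a b 0 hy0, ← psiCard_scale E a b 1 hy0]
    refine h.psiCard_le_of_psi_one ((h.cube_mul_kas_iff hy0).not.2 ha) ?_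
    rw [psi_scale, mul_one, hy]
  · have : psiCard E a b 0 = 0 := by
      rw [psiCard, card_eq_zero, filter_eq_empty_iff]
      intro y _ h1
      exact hy ⟨y, h1⟩
    omega

/-- The inequality holds for each b, and the totals over all b coincide. -/
theorem psiCard_eq (b : K) : psiCard E a b 0 = psiCard E a b 1 := by
  have := (sum_eq_sum_iff_of_le (s := univ) fun b _ => h.psiCard_le ha b).1
    (by rw [h.sum_psiCard, h.sum_psiCard])
  exact this b (mem_univ b)

include hχ hE in
/-- The Walsh transform of the Kasami function for a noncube. -/
theorem kasSum_noncube (b : K) : kasSum χ E a b = q ∨ kasSum χ E a b = -q := by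
  by_cases hy : ∃ y, y ≠ 0 ∧ psi E a b y = 0
  · obtain ⟨y, hy0, hy⟩ := hy
    rw [← kasSum_scale χ E a b hy0]
    have ha' := (h.cube_mul_kas_iff hy0).not.2 ha
    have hb : psi E (a * kas E y) (b * y) 1 = 0 := by rw [psi_scale, mul_one, hy]
    obtain ⟨hk | ⟨hk, -⟩, hk1, hk2⟩ := h.kerCard_noncube_classes ha' hb
    · right
      have := h.three_mul_kasSum_eq hχ hE ha' hk hk1 hk2
      linarith
    · left
      have := h.three_mul_kasSum_eq hχ hE ha' hk hk1 hk2
      linarith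
  -- With no zeros of `psi` there are no points of value 1 either, so the three radicals are
  -- trivial.
  · left
    have h0 : psiCard E a b 0 = 0 := by
      rw [psiCard, card_eq_zero, filter_eq_empty_iff]
      intro y _ h1
      exact hy ⟨y, h1⟩
    have h1 := h.psiCard_eq ha b
    have hsum := h.kerCard_sum ha a b
    have p0 := kerCard_pos E a b
    have p1 := kerCard_pos E (a * kas E a) (b * a)
    have p2 := kerCard_pos E (a * kas E (a ^ 2)) (b * a ^ 2)
    have := h.three_mul_kasSum_eq hχ hE ha (a := a) (b := b) (r := 0) (s := 0) (t := 0)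
      (by omega) (by omega) (by omega)
    linarith

end Noncube

end TwistedFrobenius

/-! ### Kasami sums for cubes -/

namespace TwistedFrobenius

variable {K : Type*} [Field K] [Fintype K] [CharP K 2] {E : K →+* K} {ω : K} {q : ℕ}
  (h : TwistedFrobenius E ω q)

include h

theorem card_addFour_range : 4 * (univ.filter fun w : K => ∃ z, addFour z = w).card = q ^ 2 := by
  rw [← h.card, ← Finset.card_univ, card_eq_sum_card_fiberwise (s := univ) (f := addFour)
    (t := univ.filter fun w : K => ∃ z, addFour z = w), mul_comm, ← smul_eq_mul, ← sum_const]
  · refine sum_congr rfl fun w hw => ?_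
    obtain ⟨y, rfl⟩ := (mem_filter.1 hw).2
    rw [← h.card_addFour]
    refine card_bij' (fun z _ => z + y) (fun z _ => z - y) ?_ ?_ ?_ ?_ <;> simp
    · intro z hz; rw [hz, sub_self]
  · intro z _
    simp

theorem card_not_mem_addFour_range :
    4 * (univ.filter fun w : K => ¬ ∃ z, addFour z = w).card = 3 * q ^ 2 := by
  have h1 := h.card_addFour_range
  have h2 := card_filter_add_card_filter_not (s := (univ : Finset K)) fun w => ∃ z, addFour z = w
  rw [Finset.card_univ, h.card] at h2
  omega

theorem card_cubes : 3 * (univ.filter fun a : K => a ≠ 0 ∧ ∃ c, c ^ 3 = a).card = q ^ 2 - 1 := by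
  rw [← h.card, ← Finset.card_univ, ← card_erase_of_mem (mem_univ (0 : K)),
    card_eq_sum_card_fiberwise (s := univ.erase (0 : K)) (f := fun z => z ^ 3)
    (t := univ.filter fun a : K => a ≠ 0 ∧ ∃ c, c ^ 3 = a), mul_comm, ← smul_eq_mul, ← sum_const]
  · refine sum_congr rfl fun a ha => ?_
    obtain ⟨ha0, hc⟩ := (mem_filter.1 ha).2
    have := card_cube_roots h.omega_sq ha0
    rw [if_pos hc] at this
    refine Eq.trans this.symm (congrArg Finset.card ?_)
    ext z
    simp only [mem_filter, mem_univ, true_and, mem_erase, ne_eq, and_true]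
    refine ⟨fun hz => ⟨?_, hz⟩, fun hz => hz.2⟩
    rintro rfl
    exact ha0 (by rw [← hz]; simp)
  · intro z hz
    simpa using hz

variable {χ : AddChar K ℤ} (hχ : χ.IsPrimitive) (hE : ∀ x, χ (E x) = χ x)

theorem kerCard_cube_classes {a b : K} (ha : a ≠ 0) (hc : ∃ c, c ^ 3 = a) (hb : psi E a b 1 = 0)
    {g : K} (hg : ¬ ∃ c, c ^ 3 = g) : kerCard E (a * kas E g) (b * g) = 4 ^ 0 := by
  rw [h.kerCard_noncube ha (psi_one.1 hb) hg, if_neg, pow_zero]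
  exact fun hag => hg (cube_of_mul hag hc ha)

include hχ hE

/-- Two classes have trivial radical and contribute 1 each; the remaining one contributes -2, 4 or
-8, for a total of 0, 6 or -6. -/
theorem kasSum_cube_of_isotropic {a b y : K} (ha : a ≠ 0) (hc : ∃ c, c ^ 3 = a) (hy0 : y ≠ 0)
    (hy : psi E a b y = 0) :
    kasSum χ E a b = 0 ∨ kasSum χ E a b = 2 * q ∨ kasSum χ E a b = -2 * q := by
  obtain ⟨g, hg⟩ := h.exists_noncube
  rw [← kasSum_scale χ E a b hy0]
  have hc' := (h.cube_mul_kas_iff hy0).2 hc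
  have ha' := mul_ne_zero ha (kas_ne_zero (E := E) hy0)
  have hb : psi E (a * kas E y) (b * y) 1 = 0 := by rw [psi_scale, mul_one, hy]
  have k1 := h.kerCard_cube_classes ha' hc' hb hg
  have k2 := h.kerCard_cube_classes ha' hc' hb fun hs => hg (cube_of_sq hs)
  rcases h.kerCard_self_cube ha' (psi_one.1 hb) hc' with hk | hk | hk
  · left
    have := h.three_mul_kasSum_eq hχ hE hg hk k1 k2
    linarith
  · right; left
    have := h.three_mul_kasSum_eq hχ hE hg hk k1 k2
    linarith
  · right; right
    have := h.three_mul_kasSum_eq hχ hE hg hk k1 k2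
    linarith

/-- A zero of `psi` whose associated solution of the norm equation lies outside the range of
`addFour` is the only one, and the Walsh transform vanishes. -/
theorem kasSum_eq_zero {a b y w : K} (ha : a ≠ 0) (hc : ∃ c, c ^ 3 = a) (hy0 : y ≠ 0)
    (hy : psi E a b y = 0) (hw : a * kas E y * (w * E w) = 1) (hn : ¬ ∃ z, addFour z = w) :
    kasSum χ E a b = 0 ∧ ∀ y', y' ≠ 0 → psi E a b y' = 0 → y' = y := by
  obtain ⟨g, hg⟩ := h.exists_noncube
  have hc' := (h.cube_mul_kas_iff hy0).2 hc
  have ha' := mul_ne_zero ha (kas_ne_zero (E := E) hy0)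
  have hb : psi E (a * kas E y) (b * y) 1 = 0 := by rw [psi_scale, mul_one, hy]
  have k1 := h.kerCard_cube_classes ha' hc' hb hg
  have k2 := h.kerCard_cube_classes ha' hc' hb fun hs => hg (cube_of_sq hs)
  have k0 := h.kerCard_self_of_not_mem ha' (psi_one.1 hb) hw hn
  constructor
  · rw [← kasSum_scale χ E a b hy0]
    have := h.three_mul_kasSum_eq hχ hE hg (r := 1) k0 k1 k2
    linarith
  · have hs := h.kerCard_sum hg (a * kas E y) (b * y)
    rw [k0, k1, k2, psiCard_scale E a b _ hy0, psiCard_scale E a b _ hy0] at hs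
    have h1 : psiCard E a b 0 ≤ 1 := by omega
    intro y' hy0' hy'
    exact card_le_one.1 h1 _ (by simp [hy0', hy']) _ (by simp [hy0, hy])

/-- When `psi` has no zero, each radical has order 1 or 4, so each class contributes 1 or -2 and the
total is at most 6 in absolute value. -/
theorem kasSum_sq_le {a : K} (ha : a ≠ 0) (hc : ∃ c, c ^ 3 = a) (b : K) :
    kasSum χ E a b ^ 2 ≤ 4 * q ^ 2 := by
  have hq := h.q_pos
  by_cases hy : ∃ y, y ≠ 0 ∧ psi E a b y = 0
  · obtain ⟨y, hy0, hy⟩ := hy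
    rcases h.kasSum_cube_of_isotropic hχ hE ha hc hy0 hy with h1 | h1 | h1 <;> rw [h1]
    · positivity
    · apply le_of_eq; ring
    · apply le_of_eq; ring
  · obtain ⟨g, hg⟩ := h.exists_noncube
    have hg0 : g ≠ 0 := by rintro rfl; exact hg ⟨0, by simp⟩
    have hn : ∀ y, y ≠ 0 → psi E a b y ≠ 0 := fun y hy0 h1 => hy ⟨y, hy0, h1⟩
    have hns : ∀ x, x ≠ 0 → ∀ y, y ≠ 0 → psi E (a * kas E x) (b * x) y ≠ 0 := by
      intro x hx y hy
      rw [psi_scale]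
      exact hn _ (mul_ne_zero hx hy)
    have key : kasSum χ E a b = 2 * q ∨ kasSum χ E a b = q ∨ kasSum χ E a b = 0 ∨
        kasSum χ E a b = -q ∨ kasSum χ E a b = -(2 * q) := by
      rcases h.kerCard_of_anisotropic hn with k0 | k0 <;>
      rcases h.kerCard_of_anisotropic (hns g hg0) with k1 | k1 <;>
      rcases h.kerCard_of_anisotropic (hns _ (pow_ne_zero 2 hg0)) with k2 | k2 <;>
      · have := h.three_mul_kasSum_eq hχ hE hg k0 k1 k2
        norm_num at this
        omega
    rcases key with h1 | h1 | h1 | h1 | h1 <;> rw [h1] <;> nlinarith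

/-- The pairs `(a, b)` with vanishing Walsh transform are numerous. -/
theorem card_kasSum_eq_zero :
    9 * (univ.filter fun a : K => a ≠ 0 ∧ ∃ c, c ^ 3 = a).card * q ^ 2 ≤
      12 * (((univ.filter fun a : K => a ≠ 0 ∧ ∃ c, c ^ 3 = a) ×ˢ (univ : Finset K)).filter
        fun p => kasSum χ E p.1 p.2 = 0).card := by
  have hex : ∀ a y : K, ∃ b, y ≠ 0 → psi E a b y = 0 := by
    intro a y
    by_cases hy : y = 0
    · exact ⟨0, fun h0 => (h0 hy).elim⟩
    · obtain ⟨b, hb⟩ := h.exists_psi_eq a 0 hy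
      exact ⟨b, fun _ => hb⟩
  choose B hB using hex
  -- A pair (y, w) in `S` determines a by a kas(y) w E(w) = 1 and b by the vanishing of `psi` at y.
  -- Conversely (a, b) determines y, and w up to a cube root of unity, so the map is at most
  -- three-to-one.
  let S := (univ.erase (0 : K)) ×ˢ (univ.filter fun w : K => ¬ ∃ z, addFour z = w)
  let A : K × K → K := fun p => (kas E p.1 * (p.2 * E p.2))⁻¹
  let f : K × K → K × K := fun p => (A p, B (A p) p.1)
  have hw0 : ∀ w : K, (¬ ∃ z, addFour z = w) → w * E w ≠ 0 := by
    intro w hw h0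
    apply hw
    rcases mul_eq_zero.1 h0 with h1 | h1
    · exact ⟨0, by rw [h1, map_zero]⟩
    · exact ⟨0, by rw [(map_eq_zero E).1 h1, map_zero]⟩
  have hf : ∀ p ∈ S, p.1 ≠ 0 ∧ (¬ ∃ z, addFour z = p.2) ∧ A p ≠ 0 ∧ (∃ c, c ^ 3 = A p) ∧
      A p * kas E p.1 * (p.2 * E p.2) = 1 ∧ psi E (A p) (B (A p) p.1) p.1 = 0 := by
    intro p hp
    simp only [S, mem_product, mem_erase, mem_filter, mem_univ, true_and, and_true] at hp
    have h1 := mul_ne_zero (kas_ne_zero (E := E) hp.1) (hw0 _ hp.2)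
    refine ⟨hp.1, hp.2, inv_ne_zero h1, cube_inv (cube_mul (h.kas_cube _) ?_), ?_, hB _ _ hp.1⟩
    · obtain ⟨d, hd⟩ := h.norm_cube p.2
      exact ⟨d, hd.symm⟩
    · rw [mul_assoc]
      exact inv_mul_cancel₀ h1
  have himg : S.image f ⊆ ((univ.filter fun a : K => a ≠ 0 ∧ ∃ c, c ^ 3 = a) ×ˢ
      (univ : Finset K)).filter fun p => kasSum χ E p.1 p.2 = 0 := by
    intro x hx
    obtain ⟨p, hp, rfl⟩ := mem_image.1 hx
    obtain ⟨h1, h2, h3, h4, h5, h6⟩ := hf p hp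
    rw [mem_filter, mem_product, mem_filter]
    exact ⟨⟨⟨mem_univ _, h3, h4⟩, mem_univ _⟩,
      (h.kasSum_eq_zero hχ hE h3 h4 h1 h6 h5 h2).1⟩
  have hfib : ∀ x ∈ S.image f, (S.filter fun p => f p = x).card ≤ 3 := by
    intro x hx
    obtain ⟨p, hp, rfl⟩ := mem_image.1 hx
    obtain ⟨h1, h2, h3, h4, h5, h6⟩ := hf p hp
    have hp2 : p.2 ≠ 0 := left_ne_zero_of_mul (hw0 _ h2)
    refine (card_le_card (t := ({p.2, ω * p.2, (ω + 1) * p.2} : Finset K).image (Prod.mk p.1))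
      ?_).trans (card_image_le.trans (card_triple h.omega_sq hp2).le)
    intro p' hp'
    obtain ⟨hS, he⟩ := mem_filter.1 hp'
    obtain ⟨h1', h2', h3', h4', h5', h6'⟩ := hf p' hS
    have ea : A p' = A p := congrArg Prod.fst he
    have eb : B (A p') p'.1 = B (A p) p.1 := congrArg Prod.snd he
    rw [eb, ea] at h6'
    have ey := (h.kasSum_eq_zero hχ hE h3 h4 h1 h6 h5 h2).2 _ h1' h6'
    rw [ea, ey] at h5'
    have hE2 : E p.2 ≠ 0 := right_ne_zero_of_mul (hw0 _ h2)
    have en : p'.2 * E p'.2 = p.2 * E p.2 :=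
      mul_left_cancel₀ (mul_ne_zero h3 (kas_ne_zero h1)) (h5'.trans h5.symm)
    have e3 : p'.2 ^ 3 = p.2 ^ 3 := by
      have := h.cube_eq_one_iff (x := p'.2 / p.2)
      rw [map_div₀, div_pow, div_mul_div_comm, div_eq_one_iff_eq (mul_ne_zero hp2 hE2),
        div_eq_one_iff_eq (pow_ne_zero 3 hp2)] at this
      exact this.1 en
    rw [mem_image]
    refine ⟨p'.2, ?_, Prod.ext ey.symm rfl⟩
    rw [← filter_cube_eq h.omega_sq, mem_filter]
    exact ⟨mem_univ _, e3⟩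
  have hle := (card_le_mul_card_image S 3 hfib).trans
    (Nat.mul_le_mul_left 3 (card_le_card himg))
  have hS : 4 * S.card = 9 * (univ.filter fun a : K => a ≠ 0 ∧ ∃ c, c ^ 3 = a).card * q ^ 2 := by
    have h4 := h.card_not_mem_addFour_range
    have h3 := h.card_cubes
    have he : (univ.erase (0 : K)).card = q ^ 2 - 1 := by
      rw [card_erase_of_mem (mem_univ _), Finset.card_univ, h.card]
    rw [card_product, he, ← h3, mul_left_comm, h4]
    ring
  rw [← hS]
  omega

/-- The Walsh transform of the Kasami function for a cube. -/
theorem kasSum_cube {a : K} (ha : a ≠ 0) (hc : ∃ c, c ^ 3 = a) (b : K) :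
    kasSum χ E a b = 0 ∨ kasSum χ E a b = 2 * q ∨ kasSum χ E a b = -(2 * q) := by
  set C := univ.filter fun a : K => a ≠ 0 ∧ ∃ c, c ^ 3 = a
  set Z := (C ×ˢ (univ : Finset K)).filter fun p => kasSum χ E p.1 p.2 = 0 with hZ
  have hcount : 9 * C.card * q ^ 2 ≤ 12 * Z.card := h.card_kasSum_eq_zero hχ hE
  have hterm : ∀ p ∈ C ×ˢ (univ : Finset K), kasSum χ E p.1 p.2 ^ 2 ≤
      if kasSum χ E p.1 p.2 = 0 then 0 else 4 * (q : ℤ) ^ 2 := by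
    intro p hp
    split_ifs with h0
    · rw [h0]; norm_num
    · obtain ⟨-, h1, h2⟩ := mem_filter.1 (mem_product.1 hp).1
      exact h.kasSum_sq_le hχ hE h1 h2 p.2
  have hl : ∑ p ∈ C ×ˢ (univ : Finset K), kasSum χ E p.1 p.2 ^ 2 = C.card * q ^ 4 := by
    rw [sum_product]
    simp only [h.sum_kasSum_sq hχ, sum_const, nsmul_eq_mul]
  have hr : ∑ p ∈ C ×ˢ (univ : Finset K), (if kasSum χ E p.1 p.2 = 0 then 0 else 4 * (q : ℤ) ^ 2) =
      ((C.card : ℤ) * q ^ 2 - Z.card) * (4 * (q : ℤ) ^ 2) := by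
    have h1 := card_filter_add_card_filter_not (s := C ×ˢ (univ : Finset K))
      fun p => kasSum χ E p.1 p.2 = 0
    rw [card_product, Finset.card_univ, h.card, ← hZ] at h1
    rw [sum_ite, sum_const_zero, zero_add, sum_const, nsmul_eq_mul]
    congr 1
    rw [eq_sub_iff_add_eq']
    exact_mod_cast h1
  -- At most a quarter of the pairs have a nonzero sum, so the termwise bound 4q^2 adds up to no
  -- more than the Parseval total. Equality must then hold in every term.
  have hle : ∑ p ∈ C ×ˢ (univ : Finset K),
      (if kasSum χ E p.1 p.2 = 0 then 0 else 4 * (q : ℤ) ^ 2) ≤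
        ∑ p ∈ C ×ˢ (univ : Finset K), kasSum χ E p.1 p.2 ^ 2 := by
    rw [hl, hr]
    have : (9 * C.card * q ^ 2 : ℤ) ≤ 12 * Z.card := by exact_mod_cast hcount
    have hq2 : (0 : ℤ) ≤ (q : ℤ) ^ 2 := by positivity
    nlinarith [mul_le_mul_of_nonneg_right this hq2]
  have heq := (sum_eq_sum_iff_of_le hterm).1 (le_antisymm (sum_le_sum hterm) hle) (a, b)
    (by simp [C, ha, hc])
  simp only at heq
  split_ifs at heq with h0
  · exact Or.inl h0
  · right
    apply sq_eq_sq_iff_eq_or_eq_neg.1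
    rw [heq]; ring

end TwistedFrobenius

/-! ### The polynomial σ on products of subfield elements and cubes -/

section

variable {K : Type*} [Field K]

theorem sigma_apply (q : ℕ) (x : K) : sigma K q x =
    x + x ^ ((q ^ 2 + q + 1) / 3) + (x ^ ((q ^ 2 + q + 1) / 3)) ^ q := by
  simp [sigma, sigmaPoly, pow_mul]

theorem pow_third_of_pow_eq {q : ℕ} (hq : q % 3 = 1) {t : K} (ht : t ^ q = t) :
    t ^ ((q ^ 2 + q + 1) / 3) = t := by
  obtain ⟨k, hk⟩ : ∃ k, q = 3 * k + 1 := ⟨q / 3, by omega⟩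
  have hd : (q ^ 2 + q + 1) / 3 = 3 * k * (k + 1) + 1 := by
    rw [hk]
    apply Nat.div_eq_of_eq_mul_left (by norm_num)
    ring
  rcases eq_or_ne t 0 with rfl | h0
  · rw [hd]; simp
  have h1 : t ^ (3 * k) = 1 := by
    rw [hk, pow_succ] at ht
    exact mul_right_cancel₀ h0 (by rw [ht, one_mul])
  rw [hd, pow_succ, pow_mul, h1, one_pow, one_mul]

theorem sigma_mul {q : ℕ} (hq : q % 3 = 1) {t : K} (ht : t ^ q = t) (x : K) :
    sigma K q (t * x) = t * sigma K q x := by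
  simp only [sigma_apply, mul_pow, pow_third_of_pow_eq hq ht, ht]
  ring

/-- Since 3d = q^2 + q + 1, the power (z^3)^d is z^2 z^q, and its conjugate is z (z^q)^2. -/
theorem sigma_mul_cube {q : ℕ} (hq : q % 3 = 1) (hK : ∀ x : K, (x ^ q) ^ q = x) {t : K}
    (ht : t ^ q = t) (z : K) :
    sigma K q (t * z ^ 3) = z * (t * (z ^ 2 + z * z ^ q + (z ^ q) ^ 2)) := by
  rw [sigma_mul hq ht, sigma_apply]
  have h3 : 3 * ((q ^ 2 + q + 1) / 3) = q ^ 2 + q + 1 := by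
    obtain ⟨k, hk⟩ : ∃ k, q = 3 * k + 1 := ⟨q / 3, by omega⟩
    have : q ^ 2 + q + 1 = 3 * (3 * k ^ 2 + 3 * k + 1) := by rw [hk]; ring
    omega
  have h4 : z ^ (q ^ 2 + q + 1) = z * z ^ q * z := by
    rw [pow_add, pow_add, pow_one, _root_.sq q, pow_mul, hK]
  rw [← pow_mul, h3, h4, mul_pow, mul_pow, hK]
  ring

end

/-! ### The conjugation of the quadratic extension -/

section

variable {K : Type*} [Field K] [CharP K 2] {c : K →+* K} {ω : K}

/-- The substitution z + ω c(z) diagonalizes the conjugation-invariant cubic form: only the mixed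
terms z c(z)^2 and z^2 c(z), conjugate to each other, survive. -/
theorem conj_form (hc : ∀ x, c (c x) = x) (hω : ω ^ 2 = ω + 1) (hcω : c ω = ω) (z : K) :
    (z + ω * c z) * ((z + ω * c z) ^ 2 + (z + ω * c z) * c (z + ω * c z) +
      c (z + ω * c z) ^ 2) = ω ^ 2 * (z * c z ^ 2) + ω * (z ^ 2 * c z) := by
  rw [map_add, map_mul, hc, hcω]
  grind

theorem conj_pow_nine (hω : ω ^ 2 = ω + 1) (z : K) :
    (z + ω * c z) ^ 9 = z ^ 9 + c z ^ 9 + ω ^ 2 * (z * c z ^ 8) + ω * (z ^ 8 * c z) := by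
  grind

theorem conj_eq_zero {d : K} (hc : ∀ x, c (c x) = x) (hω : ω ^ 2 = ω + 1) (hcω : c ω = ω)
    (hd : d = ω ∨ d = ω + 1) {z : K} (hz : z = d * c z) : z = 0 := by
  have hcd : c d = d := by rcases hd with rfl | rfl <;> simp [hcω]
  have hd2 : d ^ 2 = d + 1 := by rcases hd with rfl | rfl <;> grind
  have h1 : c z = d * z := by
    conv_lhs => rw [hz]
    rw [map_mul, hc, hcd]
  rw [h1] at hz
  have h2 : d * z = 0 := by grind
  exact (mul_eq_zero.1 h2).resolve_left (omega_ne_zero hd2)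

theorem conj_norm_ne_zero (hc : ∀ x, c (c x) = x) (hω : ω ^ 2 = ω + 1) (hcω : c ω = ω) {z : K}
    (hz : z ≠ 0) : z ^ 2 + z * c z + c z ^ 2 ≠ 0 := by
  intro h0
  have h1 : (z - ω * c z) * (z - (ω + 1) * c z) = 0 := by grind
  apply hz
  rcases mul_eq_zero.1 h1 with h2 | h2
  · exact conj_eq_zero hc hω hcω (Or.inl rfl) (sub_eq_zero.1 h2)
  · exact conj_eq_zero hc hω hcω (Or.inr rfl) (sub_eq_zero.1 h2)

theorem bijective_conj [Finite K] (hc : ∀ x, c (c x) = x) (hω : ω ^ 2 = ω + 1) (hcω : c ω = ω) :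
    Function.Bijective fun z => z + ω * c z := by
  refine Finite.injective_iff_bijective.1 fun x y hxy => ?_
  refine CharTwo.add_eq_zero.1 (conj_eq_zero hc hω hcω (Or.inl rfl) ?_)
  rw [map_add]
  grind

variable {χ : AddChar K ℤ}

/-- Conjugate terms have equal character values, so z^9 and c(z)^9 cancel, while the two mixed terms
combine with coefficient ω^2 + ω = 1. -/
theorem char_conj_pow_nine (hc : ∀ x, c (c x) = x) (hω : ω ^ 2 = ω + 1) (hcω : c ω = ω)
    (hχc : ∀ x, χ (c x) = χ x) {δ : K} (hδ : c δ = δ) (z : K) :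
    χ (δ * (z + ω * c z) ^ 9) = χ (δ * (z * c z ^ 8)) := by
  have e1 : δ * (z + ω * c z) ^ 9 =
      (δ * z ^ 9 + c (δ * z ^ 9)) + (δ * (ω ^ 2 * (z * c z ^ 8)) + c (δ * (ω * (z * c z ^ 8)))) := by
    rw [conj_pow_nine hω]
    simp only [map_mul, map_pow, hδ, hcω, hc]
    ring
  rw [e1, AddChar.map_add_eq_mul, AddChar.map_add_eq_mul, hχc, char_mul_self, one_mul,
    AddChar.map_add_eq_mul, hχc, ← AddChar.map_add_eq_mul]
  congr 1
  grind

theorem char_conj_form (hc : ∀ x, c (c x) = x) (hω : ω ^ 2 = ω + 1) (hcω : c ω = ω)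
    (hχc : ∀ x, χ (c x) = χ x) {t : K} (ht : c t = t) (β z : K) :
    χ (β * ((z + ω * c z) * (t * ((z + ω * c z) ^ 2 + (z + ω * c z) * c (z + ω * c z) +
      c (z + ω * c z) ^ 2)))) = χ ((ω ^ 2 * β + ω * c β) * t * (z * c z ^ 2)) := by
  have e1 : β * ((z + ω * c z) * (t * ((z + ω * c z) ^ 2 + (z + ω * c z) * c (z + ω * c z) +
      c (z + ω * c z) ^ 2))) = β * t * ω ^ 2 * (z * c z ^ 2) +
        c (c β * t * ω * (z * c z ^ 2)) := by
    rw [mul_left_comm _ t, conj_form hc hω hcω]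
    simp only [map_mul, map_pow, hc, ht, hcω]
    ring
  rw [e1, AddChar.map_add_eq_mul, hχc, ← AddChar.map_add_eq_mul]
  congr 1
  ring

end

/-! ### The Walsh transform as a Kasami sum, and the bijectivity of σ -/

section

variable {K : Type*} [Field K] [Fintype K] [CharP K 2] {c : K →+* K} {ω : K} {q : ℕ}
  {χ : AddChar K ℤ}

/-- Evaluation of the Walsh transform through the Kasami function. -/
theorem sum_char_sigma (hc : ∀ x, c (c x) = x) (hcq : ∀ x, c x = x ^ q) (hq : q % 3 = 1)
    (hω : ω ^ 2 = ω + 1) (hcω : c ω = ω) (hχc : ∀ x, χ (c x) = χ x) {E : K →+* K}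
    (h : TwistedFrobenius E ω q) (hE : ∀ x, E x = c x ^ 2) {g : K} (hg : ¬ ∃ d, d ^ 3 = g)
    (hcg : c g = g) {α : K} (hα : c α = α) (β : K) :
    ∑ y, χ (α * y ^ 3 + β * sigma K q y) = kasSum χ E α (ω ^ 2 * β + ω * c β) := by
  have hg0 : g ≠ 0 := by rintro rfl; exact hg ⟨0, by simp⟩
  have key : ∀ t, t ≠ 0 → c t = t → ∑ z, χ (α * (t * z ^ 3) ^ 3 + β * sigma K q (t * z ^ 3)) =
      quadSum χ E (α * kas E t) ((ω ^ 2 * β + ω * c β) * t) := by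
    intro t ht0 ht
    rw [← (bijective_conj hc hω hcω).sum_comp, quadSum]
    refine sum_congr rfl fun z _ => ?_
    have hkas : kas E t = t ^ 3 := by
      rw [kas, hE, ht]
      field_simp
    rw [sigma_mul_cube hq (fun x => by rw [← hcq, ← hcq, hc]) (by rw [← hcq, ht]),
      AddChar.map_add_eq_mul, AddChar.map_add_eq_mul, ← hcq, char_conj_form hc hω hcω hχc ht,
      hkas, hE]
    congr 1
    have hδ : c (α * t ^ 3) = α * t ^ 3 := by rw [map_mul, map_pow, hα, ht]
    rw [← pow_mul, ← char_conj_pow_nine hc hω hcω hχc hδ]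
    congr 1
    ring
  have h3 := sum_classes hω hg fun y => χ (α * y ^ 3 + β * sigma K q y)
  have k1 := key 1 one_ne_zero (map_one c)
  simp only [one_mul, kas_one, mul_one] at k1
  rw [k1, key g hg0 hcg, key _ (pow_ne_zero 2 hg0) (by rw [map_pow, hcg]),
    ← h.three_mul_kasSum hg] at h3
  linarith

/-- For y ≠ 0 the quotient y / σ(y)^3 lies in the subfield. So nonzero x and y with equal images
differ by a subfield factor, and homogeneity of σ over the subfield makes that factor 1. -/
theorem bijective_sigma (hc : ∀ x, c (c x) = x) (hcq : ∀ x, c x = x ^ q) (hq : q % 3 = 1)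
    (hω : ω ^ 2 = ω + 1) (hcω : c ω = ω) {g : K} (hg : ¬ ∃ d, d ^ 3 = g) (hcg : c g = g) :
    Function.Bijective (sigma K q) := by
  have hg0 : g ≠ 0 := by rintro rfl; exact hg ⟨0, by simp⟩
  have hrep : ∀ y, y ≠ 0 → sigma K q y ≠ 0 ∧ ∃ t, t ≠ 0 ∧ c t = t ∧ y = t * sigma K q y ^ 3 := by
    intro y hy
    obtain ⟨i, -, z, rfl⟩ := exists_rep_mod_cubes hg hy
    have hz : z ≠ 0 := by rintro rfl; simp at hy
    have ht : c (g ^ i) = g ^ i := by rw [map_pow, hcg]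
    have ht0 : g ^ i ≠ 0 := pow_ne_zero i hg0
    have hn := conj_norm_ne_zero hc hω hcω hz
    have hcn : c (z ^ 2 + z * c z + c z ^ 2) = z ^ 2 + z * c z + c z ^ 2 := by
      simp only [map_add, map_mul, map_pow, hc]; ring
    rw [sigma_mul_cube hq (fun x => by rw [← hcq, ← hcq, hc]) (by rw [← hcq, ht]), ← hcq]
    generalize z ^ 2 + z * c z + c z ^ 2 = n at hn hcn
    generalize g ^ i = t at ht ht0
    refine ⟨mul_ne_zero hz (mul_ne_zero ht0 hn), t / (t * n) ^ 3,
      div_ne_zero ht0 (pow_ne_zero 3 (mul_ne_zero ht0 hn)), ?_, ?_⟩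
    · rw [map_div₀, map_pow, map_mul, ht, hcn]
    · field_simp
  refine Finite.injective_iff_bijective.1 fun x y hxy => ?_
  have h0 : sigma K q 0 = 0 := by
    have := sigma_mul hq (t := (0 : K)) (zero_pow (by omega)) 0
    simpa using this
  rcases eq_or_ne x 0 with rfl | hx
  · by_contra hy
    exact (hrep y (Ne.symm hy)).1 (by rw [← hxy, h0])
  obtain ⟨hsx, t, ht0, ht, hxt⟩ := hrep x hx
  rcases eq_or_ne y 0 with rfl | hy
  · exact (hsx (by rw [hxy, h0])).elim
  obtain ⟨-, s, hs0, hs, hys⟩ := hrep y hy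
  have hyx : y = s / t * x := by
    rw [hxt, hys, hxy]; field_simp
  have hst : (s / t) ^ q = s / t := by rw [← hcq, map_div₀, hs, ht]
  have h1 := sigma_mul hq hst x
  rw [← hyx, ← hxy] at h1
  have h2 : s / t = 1 := mul_right_cancel₀ hsx (by rw [← h1, one_mul])
  rw [hyx, h2, one_mul]

/-- The Gold sum on the subfield. -/
theorem sum_char_sigma_fixed_sq (hc : ∀ x, c (c x) = x) (hcq : ∀ x, c x = x ^ q)
    (hcard : Fintype.card K = q ^ 2) (hω : ω ^ 2 = ω + 1) (hcω : c ω = ω)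
    (hχ : χ.IsPrimitive) (hχ2 : ∀ x, χ (x ^ 2) = χ x) (hχ1 : ∀ x, c x = x → χ x = 1)
    {a : K} (ha0 : a ≠ 0) (ha : c a = a) {β : K} (hβ : c β = β) :
    (∑ y, χ (a ^ 3 * y ^ 3 + β * sigma K q y)) ^ 2 = 4 * q ^ 2 := by
  have hs : ∀ y, χ (a ^ 3 * y ^ 3 + β * sigma K q y) = χ (a ^ 3 * y ^ 3 + β * y) := by
    intro y
    -- The last two terms of σ are conjugate, so for β in the subfield their contribution lies in
    -- the subfield, where the character is trivial.
    have h1 : χ (β * (y ^ ((q ^ 2 + q + 1) / 3) + c (y ^ ((q ^ 2 + q + 1) / 3)))) = 1 := by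
      apply hχ1
      rw [map_mul, map_add, hc, hβ, add_comm]
    rw [sigma_apply, ← hcq, add_assoc, mul_add, ← add_assoc, AddChar.map_add_eq_mul, h1, mul_one]
  simp only [hs]
  have hsq : Function.Bijective fun x : K => x ^ 2 := by
    refine Finite.injective_iff_bijective.1 fun x y hxy => ?_
    exact CharTwo.sq_injective hxy
  rw [sq_sum_quadratic hχ (fun y => a ^ 3 * y ^ 3 + β * y) (fun u => a ^ 3 * u + a ^ 6 * u ^ 4)
    (fun x => x ^ 2) hsq]
  · have hfil : (univ.filter fun u => a ^ 3 * u + a ^ 6 * u ^ 4 = 0) = line ω a⁻¹ := by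
      ext u
      rw [mem_line_iff_pow hω, mem_filter]
      have e : a ^ 3 * u + a ^ 6 * u ^ 4 = a ^ 3 * (u * (1 + (a * u) ^ 3)) := by ring
      rw [e, inv_pow, mul_eq_zero, mul_eq_zero, or_iff_right (pow_ne_zero 3 ha0),
        CharTwo.add_eq_zero, mul_pow, eq_comm (a := (1 : K)), mul_comm,
        mul_eq_one_iff_eq_inv₀ (pow_ne_zero 3 ha0)]
      simp
    rw [hfil, sum_congr rfl (g := fun _ => 1)]
    · rw [sum_const, card_line hω (inv_ne_zero ha0), hcard]
      simp; ring
    · intro u hu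
      apply hχ1
      have hu' : c u = u := by
        rcases mem_line.1 hu with rfl | rfl | rfl | rfl <;> simp [hcω, ha]
      simp only [map_add, map_mul, map_pow, ha, hβ, hu']
  · intro z u
    have e : a ^ 3 * z ^ 3 + β * z + (a ^ 3 * (z + u) ^ 3 + β * (z + u)) =
        a ^ 3 * u ^ 3 + β * u + (a ^ 3 * z ^ 2 * u + a ^ 3 * z * u ^ 2) := by grind
    rw [e, AddChar.map_add_eq_mul, AddChar.map_add_eq_mul (x := a ^ 3 * z ^ 2 * u),
      ← hχ2 (a ^ 3 * z * u ^ 2), ← AddChar.map_add_eq_mul (x := a ^ 3 * z ^ 2 * u)]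
    congr 2
    ring

end

/-! ### The trace character and the moments of the Walsh transform -/

section

variable (K : Type*) [Field K] [Algebra (ZMod 2) K]

theorem charP_two_of_algebra : CharP K 2 :=
  charP_of_injective_algebraMap (algebraMap (ZMod 2) K).injective 2

theorem neg_one_pow_val_add (u v : ZMod 2) :
    (-1 : ℤ) ^ (u + v).val = (-1) ^ u.val * (-1) ^ v.val := by
  revert u v; decide

/-- The additive character `x ↦ (-1) ^ Tr x`. -/
noncomputable def traceChar : AddChar K ℤ where
  toFun x := (-1) ^ (Algebra.trace (ZMod 2) K x).val
  map_zero_eq_one' := by simp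
  map_add_eq_mul' x y := by rw [map_add, neg_one_pow_val_add]

variable {K}

theorem traceChar_apply (x : K) : traceChar K x = (-1) ^ (Algebra.trace (ZMod 2) K x).val := rfl

section

variable [Finite K]

variable (K) in
theorem isPrimitive_traceChar : (traceChar K).IsPrimitive := by
  apply AddChar.IsPrimitive.of_ne_one
  obtain ⟨x, hx⟩ := Algebra.trace_surjective (ZMod 2) K 1
  intro h1
  have h2 : traceChar K x = 1 := by rw [h1]; rfl
  rw [traceChar_apply, hx] at h2
  exact absurd h2 (by decide)

theorem traceChar_sq (x : K) : traceChar K (x ^ 2) = traceChar K x := by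
  rw [traceChar_apply, traceChar_apply,
    ← Algebra.trace_eq_of_algEquiv (FiniteField.frobeniusAlgEquivOfAlgebraic (ZMod 2) K) x,
    FiniteField.coe_frobeniusAlgEquivOfAlgebraic, ZMod.card]

theorem traceChar_pow_two_pow (x : K) (n : ℕ) : traceChar K (x ^ 2 ^ n) = traceChar K x := by
  induction n with
  | zero => simp
  | succ n ih => rw [pow_succ, pow_mul, traceChar_sq, ih]

end

variable [Fintype K]

/-- The Walsh transform of `boolFun`, written as a sum over the preimages under `sigma`. -/
theorem walsh_boolFun {q : ℕ} (hσ : Function.Bijective (sigma K q)) (a β : K) :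
    walsh (boolFun q a) β = ∑ y, traceChar K (a * y ^ 3 + β * sigma K q y) := by
  rw [walsh, ← hσ.sum_comp]
  refine sum_congr rfl fun y _ => ?_
  rw [boolFun, sigmaInv, Function.leftInverse_invFun hσ.1 y, neg_one_pow_val_add,
    AddChar.map_add_eq_mul]
  rfl

theorem walsh_boolFun_eq_fourier (q : ℕ) (a β : K) :
    walsh (boolFun q a) β = ∑ x, (-1) ^ (boolFun q a x).val * traceChar K (β * x) := by
  simp only [walsh, neg_one_pow_val_add, traceChar_apply]

theorem sum_walsh_sq (q : ℕ) (a : K) :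
    ∑ β, walsh (boolFun q a) β ^ 2 = (Fintype.card K : ℤ) ^ 2 := by
  have := charP_two_of_algebra K
  simp only [walsh_boolFun_eq_fourier]
  rw [sum_sq_fourier (isPrimitive_traceChar K) fun x => (-1) ^ (boolFun q a x).val]
  simp only [← pow_mul, mul_comm _ 2]
  simp [pow_mul, Finset.card_univ, _root_.sq]

theorem sum_walsh {q : ℕ} (hq : q % 3 = 1) (hσ : Function.Bijective (sigma K q))
    (a : K) : ∑ β, walsh (boolFun q a) β = Fintype.card K := by
  simp only [walsh_boolFun_eq_fourier]
  rw [sum_fourier (isPrimitive_traceChar K) fun x => (-1) ^ (boolFun q a x).val]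
  have h0 : sigma K q 0 = 0 := by
    have := sigma_mul hq (t := (0 : K)) (zero_pow (by omega)) 0
    simpa using this
  have h1 : sigmaInv K q 0 = 0 := by
    have := Function.leftInverse_invFun hσ.1 0
    rwa [h0] at this
  rw [boolFun, h1]
  simp

end

/-! ### The automorphism x ↦ x^(2q) -/

theorem two_pow_mod_three {e : ℕ} (he : Even e) : 2 ^ e % 3 = 1 := by
  obtain ⟨k, rfl⟩ := he
  rw [← two_mul, pow_mul, Nat.pow_mod]
  norm_num

section

variable {K : Type*} [Field K] [Fintype K] [CharP K 2]

/-- The automorphism `x ↦ x ^ (2 * q)`. -/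
theorem twistedFrobenius_iterateFrobenius {e : ℕ} (he : Even e)
    (hK : Fintype.card K = (2 ^ e) ^ 2) {ω : K} (hω : ω ^ 2 = ω + 1) (hω' : ω ^ 2 ^ e = ω) :
    TwistedFrobenius (iterateFrobenius K 2 (e + 1)) ω (2 ^ e) := by
  have hc : ∀ x : K, (x ^ 2 ^ e) ^ 2 ^ e = x := by
    intro x
    rw [← pow_mul, ← _root_.sq, ← hK, FiniteField.pow_card]
  have hE : ∀ x : K, iterateFrobenius K 2 (e + 1) x = (x ^ 2 ^ e) ^ 2 := by
    intro x
    rw [iterateFrobenius_def, pow_succ, pow_mul]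
  have hq := two_pow_mod_three he
  refine ⟨hK, hq, fun x => ?_, hω, ?_, fun x => ?_, fun x hx => ?_⟩
  · rw [hE, hE, ← pow_mul _ 2 (2 ^ e), mul_comm, pow_mul, hc, ← pow_mul]
  · rw [hE, hω', hω]
  · refine ⟨x ^ ((2 * 2 ^ e + 1) / 3), ?_⟩
    rw [hE, ← pow_mul, ← pow_mul, ← pow_succ']
    congr 1
    omega
  · rw [hE] at hx
    -- Conjugating x c(x)^2 = 1 gives c(x) x^2 = 1; comparing the two yields c(x) = x, hence x^3 =
    -- 1.
    have h1 : x ^ 2 ^ e * x ^ 2 = 1 := by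
      have := congrArg (fun y => y ^ 2 ^ e) hx
      simp only [mul_pow, one_pow] at this
      rwa [← pow_mul _ 2 (2 ^ e), mul_comm 2, pow_mul, hc] at this
    have hx0 : x ≠ 0 := by rintro rfl; simp at hx
    have hx1 : x ^ 2 ^ e ≠ 0 := left_ne_zero_of_mul_eq_one h1
    have h2 : x ^ 2 ^ e = x := by
      apply mul_left_cancel₀ (mul_ne_zero hx0 hx1)
      calc x * x ^ 2 ^ e * x ^ 2 ^ e = x * (x ^ 2 ^ e) ^ 2 := by ring
        _ = x ^ 2 ^ e * x ^ 2 := by rw [hx, h1]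
        _ = x * x ^ 2 ^ e * x := by ring
    rw [h2] at h1
    rw [← h1]; ring

end

/-! ### The subfield F inside K -/

section

variable {F K : Type*} [Field F] [Fintype F] [Field K] [Fintype K] [Algebra F K]

theorem card_range_algebraMap :
    (univ.filter fun x : K => x ∈ Set.range (algebraMap F K)).card = Fintype.card F := by
  rw [← Finset.card_univ, ← card_image_of_injective _ (algebraMap F K).injective]
  congr 1
  ext x
  simp

/-- The elements of the subfield are the fixed points of its Frobenius power. -/
theorem mem_range_algebraMap_iff {x : K} :
    x ∈ Set.range (algebraMap F K) ↔ x ^ Fintype.card F = x := by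
  constructor
  · rintro ⟨y, rfl⟩
    rw [← map_pow, FiniteField.pow_card]
  · intro hx
    have h1 : 1 < Fintype.card F := Fintype.one_lt_card
    have hdeg := FiniteField.X_pow_card_sub_X_natDegree_eq K h1
    have hne := FiniteField.X_pow_card_sub_X_ne_zero K h1
    set P : Polynomial K := Polynomial.X ^ Fintype.card F - Polynomial.X
    have hroot : ∀ y : K, y ∈ P.roots.toFinset ↔ y ^ Fintype.card F = y := by
      intro y
      simp [P, hne, sub_eq_zero]
    have hsub : (univ.filter fun x : K => x ∈ Set.range (algebraMap F K)) ⊆ P.roots.toFinset := by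
      intro y hy
      obtain ⟨z, rfl⟩ := (mem_filter.1 hy).2
      rw [hroot, ← map_pow, FiniteField.pow_card]
    have hle : P.roots.toFinset.card ≤
        (univ.filter fun x : K => x ∈ Set.range (algebraMap F K)).card := by
      rw [card_range_algebraMap, ← hdeg]
      exact (Multiset.toFinset_card_le _).trans (Polynomial.card_roots' P)
    have := (hroot x).2 hx
    rw [← eq_of_subset_of_card_le hsub hle] at this
    exact (mem_filter.1 this).2

theorem exists_omega [CharP F 2] (hF : Fintype.card F % 3 = 1) : ∃ ω : F, ω ^ 2 = ω + 1 := by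
  have : Fact (Nat.Prime 3) := ⟨Nat.prime_three⟩
  obtain ⟨u, hu⟩ := exists_prime_orderOf_dvd_card (G := Fˣ) 3 (by
    rw [Fintype.card_units]; omega)
  have h3 : (u : F) ^ 3 = 1 := by
    rw [← Units.val_pow_eq_pow_val, ← hu, pow_orderOf_eq_one, Units.val_one]
  have h1 : (u : F) ≠ 1 := by
    intro h
    rw [Units.val_eq_one] at h
    rw [h, orderOf_one] at hu
    norm_num at hu
  refine ⟨u, ?_⟩
  have : ((u : F) - 1) * ((u : F) ^ 2 - (u + 1)) = 0 := by grind
  exact sub_eq_zero.1 ((mul_eq_zero.1 this).resolve_left (sub_ne_zero.2 h1))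

theorem exists_noncube_of_omega [CharP F 2] {ω : F} (hω : ω ^ 2 = ω + 1) :
    ∃ g : F, ¬ ∃ c, c ^ 3 = g := by
  by_contra! hc
  have hi := Finite.injective_iff_surjective.2 (show Function.Surjective fun x : F => x ^ 3 from hc)
  exact omega_ne_one hω (hi (by simp only; grind))

/-- An element of the subfield which is a cube is the cube of an element of the subfield. -/
theorem cube_algebraMap_iff (hK : Fintype.card K = Fintype.card F ^ 2) (x : F) :
    (∃ c, c ^ 3 = algebraMap F K x) ↔ ∃ c, c ^ 3 = x := by
  constructor
  · rintro ⟨k, hk⟩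
    -- The norm of a cube root of x lies in the subfield and has cube x^2; then x is a cube along
    -- with x^2.
    have hn : k * k ^ Fintype.card F ∈ Set.range (algebraMap F K) := by
      rw [mem_range_algebraMap_iff, mul_pow, ← pow_mul, ← _root_.sq, ← hK, FiniteField.pow_card,
        mul_comm]
    obtain ⟨d, hd⟩ := hn
    refine cube_of_sq ⟨d, (algebraMap F K).injective ?_⟩
    rw [map_pow, hd, mul_pow, ← pow_mul, mul_comm _ 3, pow_mul, hk, ← map_pow,
      FiniteField.pow_card, ← map_mul, _root_.sq]
  · rintro ⟨c, rfl⟩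
    exact ⟨algebraMap F K c, by rw [map_pow]⟩

/-- The trace character is trivial on the subfield of index two. -/
theorem traceChar_algebraMap [Algebra (ZMod 2) K] (hK : Fintype.card K = Fintype.card F ^ 2)
    (x : F) : traceChar K (algebraMap F K x) = 1 := by
  have := charP_two_of_algebra K
  have hF2 : CharP F 2 := (RingHom.charP_iff _ (algebraMap F K).injective 2).2 this
  let _ : Algebra (ZMod 2) F := ZMod.algebra F 2
  have _ : IsScalarTower (ZMod 2) F K := IsScalarTower.of_algebraMap_eq' (Subsingleton.elim _ _)
  have hr : Module.finrank F K = 2 := by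
    have := Module.card_eq_pow_finrank (K := F) (V := K)
    rw [hK] at this
    exact (Nat.pow_right_injective Fintype.one_lt_card this).symm
  rw [traceChar_apply, ← Algebra.trace_trace (S := F), Algebra.trace_algebraMap, hr, two_smul,
    CharTwo.add_self_eq_zero, map_zero]
  simp

end

/-! ### Attained values from the first two moments -/

section

variable {X : Type*} [Fintype X] {W : X → ℤ} {q : ℕ} {p : X → Prop}

theorem card_filter_not_eq (hX : Fintype.card X = q ^ 2) (hp : (univ.filter p).card = q) :
    ((univ.filter fun x => ¬ p x).card : ℤ) = q ^ 2 - q := by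
  have := card_filter_add_card_filter_not (s := (univ : Finset X)) p
  rw [Finset.card_univ, hX, hp] at this
  rw [eq_sub_iff_add_eq']
  exact_mod_cast this

theorem abs_sum_le (hp : (univ.filter p).card = q) {m : ℤ} (hW : ∀ x, p x → W x ^ 2 ≤ m ^ 2)
    (hm : 0 ≤ m) : |∑ x ∈ univ.filter p, W x| ≤ q * m := by
  refine (abs_sum_le_sum_abs _ _).trans ?_
  refine (sum_le_card_nsmul _ _ m fun x hx => ?_).trans (by rw [hp, nsmul_eq_mul])
  exact abs_le_of_sq_le_sq (hW x (mem_filter.1 hx).2) hm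

/-- Both signs occur in a two-valued spectrum. -/
theorem two_valued (hX : Fintype.card X = q ^ 2) (hp : (univ.filter p).card = q) (hq : 4 ≤ q)
    (hsum : ∑ x, W x = q ^ 2) (hW : ∀ x, W x = q ∨ W x = -q) :
    {w : ℤ | ∃ x, ¬ p x ∧ W x = w} = {(q : ℤ), -(q : ℤ)} := by
  have hq' : (4 : ℤ) ≤ q := by exact_mod_cast hq
  have hb := abs_le.1 (abs_sum_le (W := W) hp (m := q)
    (fun x _ => by rcases hW x with h | h <;> simp [h]) (by omega))
  have hc := card_filter_not_eq hX hp
  rw [← sum_filter_add_sum_filter_not univ p] at hsum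
  have key : ∀ v : ℤ, (∀ x, ¬ p x → W x = v) →
      ∑ x ∈ univ.filter (fun x => ¬ p x), W x = (q ^ 2 - q) * v := by
    intro v hv
    rw [sum_congr rfl (g := fun _ => v) fun x hx => hv x (mem_filter.1 hx).2, sum_const,
      nsmul_eq_mul, hc]
  ext w
  simp only [Set.mem_ofPred_eq, Set.mem_insert_iff, Set.mem_singleton_iff]
  constructor
  · rintro ⟨x, -, rfl⟩
    exact hW x
  · rintro (rfl | rfl) <;> by_contra! hn
    -- A constant value off `p` would give a sum of absolute value q^3 - q^2 there, while the terms
    -- on `p` can offset at most q^2; this contradicts the total q^2 for q ≥ 4.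
    · have := key (-q) fun x hx => (hW x).resolve_left (hn x hx)
      rw [this] at hsum
      nlinarith
    · have := key q fun x hx => (hW x).resolve_right (hn x hx)
      rw [this] at hsum
      nlinarith

theorem sum_sq_filter_not (hp : (univ.filter p).card = q) (hsq : ∑ x, W x ^ 2 = (q : ℤ) ^ 4)
    (hWp : ∀ x, p x → W x ^ 2 = 4 * q ^ 2) :
    ∑ x ∈ univ.filter (fun x => ¬ p x), W x ^ 2 = (q : ℤ) ^ 4 - 4 * q ^ 3 := by
  rw [← sum_filter_add_sum_filter_not univ p, sum_congr rfl (g := fun _ => 4 * (q : ℤ) ^ 2)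
    fun x hx => hWp x (mem_filter.1 hx).2, sum_const, nsmul_eq_mul, hp] at hsq
  linarith

theorem one_valued (hX : Fintype.card X = q ^ 2) (hp : (univ.filter p).card = q) (hq : q = 4)
    (hsq : ∑ x, W x ^ 2 = (q : ℤ) ^ 4) (hWp : ∀ x, p x → W x ^ 2 = 4 * q ^ 2) :
    {w : ℤ | ∃ x, ¬ p x ∧ W x = w} = {0} := by
  have h0 := sum_sq_filter_not hp hsq hWp
  have hc := card_filter_not_eq hX hp
  subst hq
  have h1 := (sum_eq_zero_iff_of_nonneg fun x _ => sq_nonneg (W x)).1 (h0.trans (by norm_num))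
  have hpos : 0 < (univ.filter fun x => ¬ p x).card := by
    zify; rw [hc]; norm_num
  obtain ⟨x, hx⟩ := card_pos.1 hpos
  ext w
  simp only [Set.mem_ofPred_eq, Set.mem_singleton_iff]
  constructor
  · rintro ⟨x, hx, rfl⟩
    exact pow_eq_zero_iff two_ne_zero |>.1 (h1 x (by simp [hx]))
  · rintro rfl
    exact ⟨x, (mem_filter.1 hx).2, pow_eq_zero_iff two_ne_zero |>.1 (h1 x hx)⟩

/-- All three values occur in a three-valued spectrum. -/
theorem three_valued (hX : Fintype.card X = q ^ 2) (hp : (univ.filter p).card = q) (hq : 16 ≤ q)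
    (hsum : ∑ x, W x = q ^ 2) (hsq : ∑ x, W x ^ 2 = (q : ℤ) ^ 4)
    (hWp : ∀ x, p x → W x ^ 2 = 4 * q ^ 2) (hW : ∀ x, W x = 0 ∨ W x = 2 * q ∨ W x = -(2 * q)) :
    {w : ℤ | ∃ x, ¬ p x ∧ W x = w} = {-2 * (q : ℤ), 0, 2 * (q : ℤ)} := by
  have hq' : (16 : ℤ) ≤ q := by exact_mod_cast hq
  have hb := abs_le.1 (abs_sum_le (W := W) hp (m := 2 * q)
    (fun x hx => by rw [hWp x hx]; apply le_of_eq; ring) (by omega))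
  have hc := card_filter_not_eq hX hp
  have h2 := sum_sq_filter_not hp hsq hWp
  rw [← sum_filter_add_sum_filter_not univ p] at hsum
  have key : ∀ v : ℤ, (∀ x, ¬ p x → W x ^ 2 = v * W x) →
      (q : ℤ) ^ 4 - 4 * q ^ 3 = v * ∑ x ∈ univ.filter (fun x => ¬ p x), W x := by
    intro v hv
    rw [← h2, mul_sum]
    exact sum_congr rfl fun x hx => hv x (mem_filter.1 hx).2
  have hq3 : (0 : ℤ) < (q : ℤ) ^ 3 := by positivity
  ext w
  simp only [Set.mem_ofPred_eq, Set.mem_insert_iff, Set.mem_singleton_iff]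
  constructor
  · rintro ⟨x, -, rfl⟩
    rcases hW x with h | h | h
    · exact Or.inr (Or.inl h)
    · exact Or.inr (Or.inr h)
    · exact Or.inl (by rw [h]; ring)
  · rintro (rfl | rfl | rfl) <;> by_contra! hn
    -- If -2q is missed, then W^2 = 2q W off `p`, so W sums to q^3/2 - 2q^2 there; but the total q^2
    -- and the bound 2q^2 on `p` allow at most 3q^2.
    · have := key (2 * q) fun x hx => by
        rcases hW x with h | h | h
        · rw [h]; ring
        · rw [h]; ring
        · exact (hn x hx (by rw [h]; ring)).elim
      nlinarith
    -- If 0 is missed, the second moment off `p` is 4q^2 (q^2 - q), exceeding the available q^4 -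
    -- 4q^3.
    · have : ∀ x ∈ univ.filter (fun x => ¬ p x), W x ^ 2 = 4 * (q : ℤ) ^ 2 := by
        intro x hx
        rcases hW x with h | h | h
        · exact (hn x (mem_filter.1 hx).2 h).elim
        · rw [h]; ring
        · rw [h]; ring
      rw [sum_congr rfl this, sum_const, nsmul_eq_mul, hc] at h2
      nlinarith
    · have := key (-(2 * q)) fun x hx => by
        rcases hW x with h | h | h
        · rw [h]; ring
        · exact (hn x hx (by rw [h])).elim
        · rw [h]; ring
      nlinarith

end

end WalshInverse


/-! ### Assembly for the quadratic extension -/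

theorem mainTheorem1 {F K : Type*} [Field F] [Fintype F] [Field K] [Fintype K]
    [Algebra F K] [Algebra (ZMod 2) K]
    (e q : ℕ) (he_pos : 0 < e) (he_even : Even e) (hq : q = 2 ^ e)
    (hF : Fintype.card F = q) (hK : Fintype.card K = q ^ 2)
    (α : F) (hα : α ≠ 0) :
    Function.Bijective (WalshInverse.sigma K q) ∧
    ((∃ c : F, c ^ 3 = α) →
      (e = 2 →
        {w : ℤ | ∃ β : K, β ∉ Set.range (algebraMap F K) ∧
          WalshInverse.walsh (WalshInverse.boolFun q (algebraMap F K α)) β = w} = {0}) ∧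
      (4 ≤ e →
        {w : ℤ | ∃ β : K, β ∉ Set.range (algebraMap F K) ∧
          WalshInverse.walsh (WalshInverse.boolFun q (algebraMap F K α)) β = w} =
          {-2 * (q : ℤ), 0, 2 * (q : ℤ)})) ∧
    ((¬ ∃ c : F, c ^ 3 = α) →
      {w : ℤ | ∃ β : K, β ∉ Set.range (algebraMap F K) ∧
        WalshInverse.walsh (WalshInverse.boolFun q (algebraMap F K α)) β = w} =
        {(q : ℤ), -(q : ℤ)}) := by
  open WalshInverse in
  have hchar : CharP K 2 := charP_two_of_algebra K
  have hcharF : CharP F 2 := (RingHom.charP_iff _ (algebraMap F K).injective 2).2 hchar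
  have hq3 : q % 3 = 1 := by rw [hq]; exact two_pow_mod_three he_even
  have hKF : Fintype.card K = Fintype.card F ^ 2 := by rw [hK, hF]
  obtain ⟨ω, hω⟩ := exists_omega (F := F) (by rw [hF, hq3])
  obtain ⟨g, hg⟩ := exists_noncube_of_omega hω
  have hωK : algebraMap F K ω ^ 2 = algebraMap F K ω + 1 := by
    rw [← map_pow, hω, map_add, map_one]
  have hgK : ¬ ∃ c, c ^ 3 = algebraMap F K g := (cube_algebraMap_iff hKF g).not.2 hg
  set c : K →+* K := iterateFrobenius K 2 e
  have hcq : ∀ x, c x = x ^ q := fun x => by rw [hq]; exact iterateFrobenius_def 2 e x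
  have hcc : ∀ x, c (c x) = x := fun x => by
    rw [hcq, hcq, ← pow_mul, ← _root_.sq, ← hK, FiniteField.pow_card]
  have hcF : ∀ x : F, c (algebraMap F K x) = algebraMap F K x := fun x => by
    rw [hcq, ← map_pow, ← hF, FiniteField.pow_card]
  have hT : TwistedFrobenius (iterateFrobenius K 2 (e + 1)) (algebraMap F K ω) q := by
    subst hq
    exact twistedFrobenius_iterateFrobenius he_even hK hωK (by rw [← hcq, hcF])
  have hE : ∀ x, iterateFrobenius K 2 (e + 1) x = c x ^ 2 := fun x => by
    rw [hcq, hq, iterateFrobenius_def, pow_succ, pow_mul]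
  have hχ := isPrimitive_traceChar K
  have hχc : ∀ x, traceChar K (c x) = traceChar K x := fun x => by
    rw [hcq, hq, traceChar_pow_two_pow]
  have hχE : ∀ x, traceChar K (iterateFrobenius K 2 (e + 1) x) = traceChar K x := fun x => by
    rw [hE, traceChar_sq, hχc]
  have hσ : Function.Bijective (sigma K q) :=
    bijective_sigma hcc hcq hq3 hωK (hcF ω) hgK (hcF g)
  have hα0 : algebraMap F K α ≠ 0 := by simpa using hα
  have hlink : ∀ β, walsh (boolFun q (algebraMap F K α)) β =
      kasSum (traceChar K) (iterateFrobenius K 2 (e + 1)) (algebraMap F K α)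
        (algebraMap F K ω ^ 2 * β + algebraMap F K ω * c β) := fun β => by
    rw [walsh_boolFun hσ]
    exact sum_char_sigma hcc hcq hq3 hωK (hcF ω) hχc hT hE hgK (hcF g) (hcF α) β
  have hsum : ∑ β, walsh (boolFun q (algebraMap F K α)) β = (q : ℤ) ^ 2 := by
    rw [sum_walsh hq3 hσ, hK]; push_cast; rfl
  have hsq : ∑ β, walsh (boolFun q (algebraMap F K α)) β ^ 2 = (q : ℤ) ^ 4 := by
    rw [sum_walsh_sq, hK]; push_cast; ring
  have hR := (card_range_algebraMap (F := F) (K := K)).trans hF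
  have hpow : ∀ n, n ≤ e → 2 ^ n ≤ q := fun n hn => by
    rw [hq]; exact Nat.pow_le_pow_right (by norm_num) hn
  have he2 : 2 ≤ e := by obtain ⟨k, rfl⟩ := he_even; omega
  refine ⟨hσ, fun hc => ?_, fun hn => ?_⟩
  · have hcK := (cube_algebraMap_iff hKF α).2 hc
    have hRsq : ∀ β : K, β ∈ Set.range (algebraMap F K) →
        walsh (boolFun q (algebraMap F K α)) β ^ 2 = 4 * (q : ℤ) ^ 2 := by
      rintro _ ⟨β, rfl⟩
      obtain ⟨a, rfl⟩ := hc
      have ha0 : algebraMap F K a ≠ 0 := by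
        intro h0
        apply hα0
        rw [map_pow, h0]; simp
      rw [walsh_boolFun hσ, map_pow]
      refine sum_char_sigma_fixed_sq hcc hcq hK hωK (hcF ω) hχ traceChar_sq (fun x hx => ?_) ha0
        (hcF a) (hcF β)
      obtain ⟨y, rfl⟩ := mem_range_algebraMap_iff.2 (by rw [hF, ← hcq, hx])
      exact traceChar_algebraMap hKF y
    refine ⟨fun he => ?_, fun he => ?_⟩
    · exact one_valued hK (by convert hR) (by rw [hq, he]; norm_num) hsq hRsq
    · refine three_valued hK (by convert hR) (hpow 4 he) hsum hsq hRsq fun β => ?_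
      rw [hlink]
      exact hT.kasSum_cube hχ hχE hα0 hcK _
  · refine two_valued hK (by convert hR) (hpow 2 he2) hsum fun β => ?_
    rw [hlink]
    exact hT.kasSum_noncube hχ hχE ((cube_algebraMap_iff hKF α).not.2 hn) _
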